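/- Let $0<k\le l$ be integers, let $F_1\subsetneq F_2\subsetneq\dots\subsetneq F_m$ be linear subspaces of $\mathbb{C}^l$, put $j_\alpha=\dim F_\alpha$, and let $i_1,\dots,i_m$ be integers such that $$0\le i_1\le\dots\le i_m\le k\le l+i_\alpha-j_\alpha,\qquad i_\alpha\le j_\alpha\quad\text{for all }\alpha,\qquad i_\beta-i_\alpha\le j_\beta-j_\alpha\quad\text{for all }\alpha\le\beta .$$ Let $\mathbb{G}_k(\mathbb{C}^l)$ be the Grassmannian of $k$-dimensional subspaces of $\mathbb{C}^l$ and consider the Schubert variety $$\Delta=\{V\in\mathbb{G}_k(\mathbb{C}^l)\;:\;\dim(V\cap F_\alpha)\ge i_\alpha,\ \alpha=1,\dots,m\}.$$ Call an index $\alpha$ essential if $0<i_\alpha$, $k+j_\alpha<l+i_\alpha$, $i_\beta<i_\alpha$ for all $\beta<\alpha$, and $i_\beta-i_\alpha<j_\beta-j_\alpha$ for all $\beta>\alpha$ (that is, the condition $\dim(V\cap F_\alpha)\ge i_\alpha$ is not redundant). Let $\alpha_1<\dots<\alpha_\omega$ be the essential indices, and put $$\Delta^0=\{V\in\mathbb{G}_k(\mathbb{C}^l)\;:\;\dim(V\cap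 F_{\alpha})=i_{\alpha}\ \text{for every essential }\alpha\},$$ $$\tilde\Delta=\Big\{(Z_1,\dots,Z_\omega,V)\in\prod_{s=1}^{\omega}\mathbb{G}_{i_{\alpha_s}}(F_{\alpha_s})\times\mathbb{G}_k(\mathbb{C}^l)\;:\;Z_1\subseteq\dots\subseteq Z_\omega\subseteq V\Big\}.$$ Then $\Delta$ and $\tilde\Delta$ are Zariski closed in the respective (products of) Grassmannians, $\tilde\Delta$ is smooth, and the projection $$\pi:\tilde\Delta\to\Delta,\qquad (Z_1,\dots,Z_\omega,V)\mapsto V,$$ is well defined and is a resolution of singularities, that is, $\tilde\Delta$ is irreducible and smooth, and $\pi$ is a proper birational morphism of complex algebraic varieties. More precisely, $\Delta^0$ is a dense Zariski-open subset of $\Delta$, its preimage $\pi^{-1}(\Delta^0)$ is dense in $\tilde\Delta$, and $\pi$ restricts to an isomorphism of varieties $\pi^{-1}(\Delta^0)\to\Delta^0$. -/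

import Mathlib

open Topology

noncomputable section

namespace SchubertResolution

/-! ## Quasi-projective varieties in products of Grassmannians

Varieties are classical complex varieties, given by their points.  The ambient spaces are the
finite products of Grassmannians (among them the products of projective spaces, `k = 1`).  A
Grassmannian is the quotient of the variety of `k`-frames by the change of basis, and its Zariski
topology and its regular functions are those of this quotient. -/

/-- The Grassmannian of `k`-dimensional linear subspaces of `ℂⁿ`. -/
def Gr (k n : ℕ) : Type :=
  {V : Submodule ℂ (Fin n → ℂ) // Module.finrank ℂ V = k}

/-- The product over `a : ι` of the Grassmannians of `k a`-dimensional subspaces of `ℂ^(n a)`. -/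
def MultiGr {ι : Type} (k n : ι → ℕ) : Type :=
  ∀ a, Gr (k a) (n a)

/-- The index type of the coordinates of a family of frames: the `j`-th coordinate of the `i`-th
vector of the `a`-th frame. -/
abbrev Coord {ι : Type} (k n : ι → ℕ) : Type :=
  Σ a : ι, Fin (k a) × Fin (n a)

/-- The Zariski topology of the affine space `ℂ^σ`, whose basic open sets are the sets on which
a polynomial does not vanish. -/
abbrev zariskiAffine (σ : Type) : TopologicalSpace (σ → ℂ) :=
  TopologicalSpace.generateFrom
    {U | ∃ P : MvPolynomial σ ℂ, U = {v | MvPolynomial.eval v P ≠ 0}}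

variable {ι ι' κ : Type}

/-- Families of frames: for each `a`, a linearly independent `k a`-tuple of vectors of
`ℂ^(n a)`. -/
def Frame (k n : ι → ℕ) : Type :=
  {A : ∀ a, Fin (k a) → Fin (n a) → ℂ // ∀ a, LinearIndependent ℂ (A a)}

/-- All the coordinates of a family of frames, as a point of an affine space. -/
def Frame.coords {k n : ι → ℕ} (A : Frame k n) : Coord k n → ℂ :=
  fun s => A.1 s.1 s.2.1 s.2.2

/-- The spaces spanned by a family of frames. -/
def Frame.toGr {k n : ι → ℕ} (A : Frame k n) : MultiGr k n :=
  fun a => ⟨Submodule.span ℂ (Set.range (A.1 a)), by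
    simpa using finrank_span_eq_card (A.2 a)⟩

/-- The Zariski topology of a product of Grassmannians: the quotient topology of the Zariski
topology on frames.  Subsets carry the induced topology. -/
instance zariski (k n : ι → ℕ) : TopologicalSpace (MultiGr k n) :=
  TopologicalSpace.coinduced Frame.toGr
    (TopologicalSpace.induced Frame.coords (zariskiAffine (Coord k n)))

variable {k n : ι → ℕ} {k' n' : ι' → ℕ}

/-- `f : X → ℂ` is regular at `x`: in terms of frames it is, in a Zariski neighbourhood of every
frame of `x`, a quotient of two polynomials. -/
def RegularAt {X : Set (MultiGr k n)} (f : X → ℂ) (x : X) : Prop :=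
  ∀ A : Frame k n, A.toGr = x.1 → ∃ P Q : MvPolynomial (Coord k n) ℂ,
    MvPolynomial.eval A.coords Q ≠ 0 ∧
    ∀ (B : Frame k n) (y : X), B.toGr = y.1 → MvPolynomial.eval B.coords Q ≠ 0 →
      f y = MvPolynomial.eval B.coords P / MvPolynomial.eval B.coords Q

theorem RegularAt.const {X : Set (MultiGr k n)} (c : ℂ) (x : X) :
    RegularAt (fun _ : X => c) x := fun A _ =>
  ⟨MvPolynomial.C c, 1, by simp, by simp⟩

theorem RegularAt.add {X : Set (MultiGr k n)} {f g : X → ℂ} {x : X}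
    (hf : RegularAt f x) (hg : RegularAt g x) : RegularAt (f + g) x := fun A hA => by
  obtain ⟨P, Q, hQ, h⟩ := hf A hA
  obtain ⟨P', Q', hQ', h'⟩ := hg A hA
  refine ⟨P * Q' + Q * P', Q * Q', by simp [hQ, hQ'], fun B y hB hne => ?_⟩
  simp only [map_mul, mul_ne_zero_iff] at hne
  simp only [Pi.add_apply, map_mul, map_add, h B y hB hne.1, h' B y hB hne.2]
  exact div_add_div _ _ hne.1 hne.2

theorem RegularAt.mul {X : Set (MultiGr k n)} {f g : X → ℂ} {x : X}
    (hf : RegularAt f x) (hg : RegularAt g x) : RegularAt (f * g) x := fun A hA => by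
  obtain ⟨P, Q, hQ, h⟩ := hf A hA
  obtain ⟨P', Q', hQ', h'⟩ := hg A hA
  refine ⟨P * P', Q * Q', by simp [hQ, hQ'], fun B y hB hne => ?_⟩
  simp only [map_mul, mul_ne_zero_iff] at hne
  simp only [Pi.mul_apply, map_mul, h B y hB hne.1, h' B y hB hne.2]
  exact div_mul_div_comm _ _ _ _

/-- The local ring of `X` at `x`: the ring of germs at `x` (for the Zariski topology of `X`) of
functions that are regular at `x`. -/
def localRing (X : Set (MultiGr k n)) (x : X) : Subring (Filter.Germ (𝓝 x) ℂ) where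
  carrier := {g | ∃ f : X → ℂ, RegularAt f x ∧ (f : Filter.Germ (𝓝 x) ℂ) = g}
  zero_mem' := ⟨_, RegularAt.const 0 x, rfl⟩
  one_mem' := ⟨_, RegularAt.const 1 x, rfl⟩
  add_mem' := by
    rintro _ _ ⟨f, hf, rfl⟩ ⟨g, hg, rfl⟩
    exact ⟨f + g, hf.add hg, rfl⟩
  mul_mem' := by
    rintro _ _ ⟨f, hf, rfl⟩ ⟨g, hg, rfl⟩
    exact ⟨f * g, hf.mul hg, rfl⟩
  neg_mem' := by
    rintro _ ⟨f, hf, rfl⟩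
    refine ⟨(fun _ => -1) * f, (RegularAt.const (-1) x).mul hf, ?_⟩
    have h : (fun _ => -1) * f = -f := by ext y; simp
    rw [h]
    rfl

/-- `X` is smooth: all its local rings are regular. -/
def IsSmooth (X : Set (MultiGr k n)) : Prop :=
  ∀ x : X, IsRegularLocalRing (localRing X x)

/-- Morphisms of varieties: continuous maps that pull regular functions back to regular
functions. -/
structure IsMorphism {X : Set (MultiGr k n)} {Y : Set (MultiGr k' n')} (f : X → Y) : Prop where
  continuous : Continuous f
  regular : ∀ (x : X) (g : Y → ℂ), RegularAt g (f x) → RegularAt (g ∘ f) x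

/-- Isomorphisms of varieties. -/
def IsIsomorphism {X : Set (MultiGr k n)} {Y : Set (MultiGr k' n')} (f : X → Y) : Prop :=
  IsMorphism f ∧ ∃ g : Y → X, IsMorphism g ∧ Function.LeftInverse g f ∧ Function.RightInverse g f

/-- The restriction `f⁻¹(U) → U` of `f : X → Y` over a subset `U` of `Y`. -/
def restrictOver {X : Set (MultiGr k n)} {Y : Set (MultiGr k' n')} (f : X → Y) (U : Set Y) :
    (Subtype.val '' (f ⁻¹' U) : Set (MultiGr k n)) → (Subtype.val '' U : Set (MultiGr k' n')) :=
  fun x => ⟨(f ⟨x.1, Subtype.coe_image_subset X _ x.2⟩).1, by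
    obtain ⟨_, y, hy, rfl⟩ := x
    exact ⟨f y, hy, rfl⟩⟩

/-- `f : X → Y` is an isomorphism over the subset `U` of `Y`. -/
def IsIsomorphismOver {X : Set (MultiGr k n)} {Y : Set (MultiGr k' n')} (f : X → Y) (U : Set Y) :
    Prop :=
  IsIsomorphism (restrictOver f U)

/-- The product of two varieties, in the product of the ambient spaces. -/
def prodVar {m r : κ → ℕ} (X : Set (MultiGr k n)) (Z : Set (MultiGr m r)) :
    Set (MultiGr (Sum.elim k m) (Sum.elim n r)) :=
  {w | (fun a => w (Sum.inl a) : MultiGr k n) ∈ X ∧ (fun b => w (Sum.inr b) : MultiGr m r) ∈ Z}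

/-- The map `f × id : X × Z → Y × Z`. -/
def prodMapId {m r : κ → ℕ} {X : Set (MultiGr k n)} {Y : Set (MultiGr k' n')} (f : X → Y)
    (Z : Set (MultiGr m r)) : prodVar X Z → prodVar Y Z :=
  fun w => ⟨fun c => match c with
    | Sum.inl a => (f ⟨fun a => w.1 (Sum.inl a), w.2.1⟩).1 a
    | Sum.inr b => w.1 (Sum.inr b),
    (f ⟨fun a => w.1 (Sum.inl a), w.2.1⟩).2, w.2.2⟩

/-- Proper morphisms: `f × id : X × Z → Y × Z` is closed for every quasi-projective variety `Z`.
(Separatedness is automatic for quasi-projective varieties.) -/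
structure IsProperMorphism {X : Set (MultiGr k n)} {Y : Set (MultiGr k' n')} (f : X → Y) :
    Prop where
  morphism : IsMorphism f
  universallyClosed : ∀ (κ : Type) [Finite κ] (m r : κ → ℕ) (Z : Set (MultiGr m r)),
    IsLocallyClosed Z → IsClosedMap (prodMapId f Z)

/-- Birational morphisms: isomorphisms over a dense open set with dense preimage. -/
def IsBirationalMorphism {X : Set (MultiGr k n)} {Y : Set (MultiGr k' n')} (f : X → Y) : Prop :=
  IsMorphism f ∧ ∃ U : Set Y, IsOpen U ∧ Dense U ∧ Dense (f ⁻¹' U) ∧ IsIsomorphismOver f U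

/-- `f : X → Y` is a resolution of singularities of `Y`: it is proper and birational, and `X` is
an irreducible smooth variety. -/
structure IsResolution {X : Set (MultiGr k n)} {Y : Set (MultiGr k' n')} (f : X → Y) : Prop where
  irreducible : IrreducibleSpace X
  smooth : IsSmooth X
  proper : IsProperMorphism f
  birational : IsBirationalMorphism f

/-! ## Schubert varieties -/

/-- A flag `F₁ ⊂ ⋯ ⊂ F_m` in `ℂ^l`, with `dim F_α = j_α`, and integers
`0 ≤ i₁ ≤ ⋯ ≤ i_m ≤ k ≤ l + i_α - j_α` such that `i_α ≤ j_α` and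
`i_β - i_α ≤ j_β - j_α` for `α ≤ β`. -/
structure IsSchubertPair (k : ℕ) {l m : ℕ} (F : Fin m → Submodule ℂ (Fin l → ℂ))
    (i : Fin m → ℕ) : Prop where
  flag : StrictMono F
  mono : Monotone i
  le_k : ∀ α, i α ≤ k
  k_le : ∀ α, k + Module.finrank ℂ (F α) ≤ l + i α
  le_dim : ∀ α, i α ≤ Module.finrank ℂ (F α)
  slope : ∀ α β, α ≤ β → i β + Module.finrank ℂ (F α) ≤ i α + Module.finrank ℂ (F β)

/-- The condition `dim (V ∩ F_α) ≥ i_α` is not redundant: it follows neither from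
`dim V = k` (it would if `i_α = 0` or `i_α ≤ k - (l - j_α)`), nor from the condition of some
`β < α` (it would if `i_α ≤ i_β`), nor from the condition of some `β > α` (it would if
`i_α ≤ i_β - (j_β - j_α)`). -/
def IsEssential (k : ℕ) {l m : ℕ} (F : Fin m → Submodule ℂ (Fin l → ℂ)) (i : Fin m → ℕ)
    (α : Fin m) : Prop :=
  0 < i α ∧ k + Module.finrank ℂ (F α) < l + i α ∧ (∀ β, β < α → i β < i α) ∧
    ∀ β, α < β → i β + Module.finrank ℂ (F α) < i α + Module.finrank ℂ (F β)

/-- The Grassmannian of `k`-dimensional subspaces of `ℂ^l` as an ambient space. -/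
abbrev Grass (k l : ℕ) : Type :=
  MultiGr (fun _ : Unit => k) (fun _ : Unit => l)

/-- The Schubert variety `Δ = {V | dim (V ∩ F_α) ≥ i_α for all α}`. -/
def schubert (k : ℕ) {l m : ℕ} (F : Fin m → Submodule ℂ (Fin l → ℂ)) (i : Fin m → ℕ) :
    Set (Grass k l) :=
  {V | ∀ α, i α ≤ Module.finrank ℂ ((V ()).1 ⊓ F α : Submodule ℂ (Fin l → ℂ))}

/-- The set `Δ⁰ = {V | dim (V ∩ F_α) = i_α for all essential α}`. -/
def schubertOpen (k : ℕ) {l m : ℕ} (F : Fin m → Submodule ℂ (Fin l → ℂ)) (i : Fin m → ℕ) :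
    Set (Grass k l) :=
  {V | ∀ α, IsEssential k F i α →
    Module.finrank ℂ ((V ()).1 ⊓ F α : Submodule ℂ (Fin l → ℂ)) = i α}

/-- The dimensions of the members of a chain `(Z_α)_α, V`, with `α` essential: `dim Z_α = i_α`
(index `some α`) and `dim V = k` (index `none`). -/
def chainDim (k : ℕ) {l m : ℕ} (F : Fin m → Submodule ℂ (Fin l → ℂ)) (i : Fin m → ℕ) :
    Option {α // IsEssential k F i α} → ℕ
  | some α => i α.1
  | none => k

/-- The product of the Grassmannians that contains the chains `(Z_α)_α, V`. -/
abbrev ChainAmbient (k : ℕ) {l m : ℕ} (F : Fin m → Submodule ℂ (Fin l → ℂ)) (i : Fin m → ℕ) :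
    Type :=
  MultiGr (chainDim k F i) (fun _ => l)

/-- The incidence variety of the chains `Z_{α₁} ⊆ ⋯ ⊆ Z_{α_ω} ⊆ V` with `Z_α ⊆ F_α`, where
`α₁ < ⋯ < α_ω` are the essential indices. -/
def incidence (k : ℕ) {l m : ℕ} (F : Fin m → Submodule ℂ (Fin l → ℂ)) (i : Fin m → ℕ) :
    Set (ChainAmbient k F i) :=
  {x | (∀ α, (x (some α)).1 ≤ F α.1) ∧ (∀ α β, α ≤ β → (x (some α)).1 ≤ (x (some β)).1) ∧
    ∀ α, (x (some α)).1 ≤ (x none).1}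

/-- The projection `((Z_α)_α, V) ↦ V`. -/
def lastSpace (k : ℕ) {l m : ℕ} (F : Fin m → Submodule ℂ (Fin l → ℂ)) (i : Fin m → ℕ)
    (x : ChainAmbient k F i) : Grass k l :=
  fun _ => x none

end SchubertResolution

end

open SchubertResolution

noncomputable section

namespace SchubertResolution

variable {ι ι' ι'' ι₁ ι₂ κ : Type} {k n : ι → ℕ} {k' n' : ι' → ℕ} {k'' n'' : ι'' → ℕ}

/-! A chain is encoded by a single `k`-tuple of vectors. Let `step p` be the first member of the
chain of dimension greater than `p`. If the `p`-th vector always lies in that member and the tuple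
is independent, then the first `dim a` vectors form a basis of every member `a`. Hence chains are
parametrized by the independent tuples whose `p`-th vector lies in a prescribed linear space, an
open subset of an affine space; this gives irreducibility (`ChainData.irreducibleSpace_variety`).
Near a given chain, letting the `p`-th vector vary only along a complement of the member in its
prescribed space makes the tuple unique. This is a chart, and it turns the local ring into a
localization of a polynomial ring (`ChainData.isSmooth_variety`, `isRegularLocalRing_of_chart`).

Over $\Delta^0$ dimensions force $Z_\alpha=V\cap F_\alpha$, so fibres are points. The inverse is a
morphism because an intersection of constant dimension has local frames with polynomial entries
(`exists_frame_inf`). A greedy choice of vectors inside the $V\cap F_\alpha$ shows that $\pi$ is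
onto; a choice in general position shows that $\Delta^0$ is nonempty
(`exists_lastSpace_mem_schubertOpen`). Irreducibility then makes $\pi^{-1}(\Delta^0)$ dense, and its
image $\Delta^0$ is dense too.

Since $\pi$ only forgets subspaces, properness is the completeness of Grassmannians
(`isClosed_forget_one`). The vectors of a frame are eliminated one at a time, by a Nullstellensatz
form of elimination theory (`exists_elimination`).

The passage to frames loses nothing: `Frame.toGr` is an open map, so neighbourhoods and morphisms
can be tested on polynomial lifts (`IsMorphism.of_lift`). -/

/-! ## Polynomial functions -/

/-- A function on an affine space that is given by a polynomial. -/
def IsPoly {σ : Type} (f : (σ → ℂ) → ℂ) : Prop :=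
  ∃ P : MvPolynomial σ ℂ, ∀ v, f v = MvPolynomial.eval v P

namespace IsPoly

variable {σ τ α : Type} {f g : (σ → ℂ) → ℂ}

theorem const (c : ℂ) : IsPoly fun _ : σ → ℂ => c := ⟨MvPolynomial.C c, by simp⟩

theorem coord (s : σ) : IsPoly fun v : σ → ℂ => v s := ⟨MvPolynomial.X s, by simp⟩

theorem eval (P : MvPolynomial σ ℂ) : IsPoly fun v => MvPolynomial.eval v P := ⟨P, fun _ => rfl⟩

theorem add (hf : IsPoly f) (hg : IsPoly g) : IsPoly fun v => f v + g v := by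
  obtain ⟨P, hP⟩ := hf
  obtain ⟨Q, hQ⟩ := hg
  exact ⟨P + Q, by simp [hP, hQ]⟩

theorem mul (hf : IsPoly f) (hg : IsPoly g) : IsPoly fun v => f v * g v := by
  obtain ⟨P, hP⟩ := hf
  obtain ⟨Q, hQ⟩ := hg
  exact ⟨P * Q, by simp [hP, hQ]⟩

theorem sum (s : Finset α) {f : α → (σ → ℂ) → ℂ} (hf : ∀ i ∈ s, IsPoly (f i)) :
    IsPoly fun v => ∑ i ∈ s, f i v := by
  classical
  induction s using Finset.induction_on with
  | empty => simpa using const 0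
  | insert a s ha ih =>
    simp only [Finset.sum_insert ha]
    exact (hf a (by simp)).add (ih fun i hi => hf i (by simp [hi]))

theorem prod (s : Finset α) {f : α → (σ → ℂ) → ℂ} (hf : ∀ i ∈ s, IsPoly (f i)) :
    IsPoly fun v => ∏ i ∈ s, f i v := by
  classical
  induction s using Finset.induction_on with
  | empty => simpa using const 1
  | insert a s ha ih =>
    simp only [Finset.prod_insert ha]
    exact (hf a (by simp)).mul (ih fun i hi => hf i (by simp [hi]))

theorem comp {R : (τ → ℂ) → σ → ℂ} (hf : IsPoly f) (hR : ∀ s, IsPoly fun v => R v s) :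
    IsPoly fun v => f (R v) := by
  obtain ⟨P, hP⟩ := hf
  choose T hT using hR
  refine ⟨MvPolynomial.bind₁ T P, fun v => ?_⟩
  have h : R v = fun s => MvPolynomial.eval v (T s) := funext fun s => hT s v
  simp only [hP, h]
  change _ = (MvPolynomial.eval₂Hom (RingHom.id ℂ) v) _
  rw [MvPolynomial.eval₂Hom_bind₁]
  rfl

variable {m m' m'' : Type} [Fintype m] [DecidableEq m]

theorem det {M : (σ → ℂ) → Matrix m m ℂ} (hM : ∀ i j, IsPoly fun v => M v i j) :
    IsPoly fun v => (M v).det := by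
  simp only [Matrix.det_apply, Units.smul_def, zsmul_eq_mul]
  exact sum _ fun p _ => (const _).mul (prod _ fun i _ => hM _ _)

theorem adjugate {M : (σ → ℂ) → Matrix m m ℂ} (hM : ∀ i j, IsPoly fun v => M v i j) (i j : m) :
    IsPoly fun v => (M v).adjugate i j := by
  simp only [Matrix.adjugate_apply]
  refine det fun a b => ?_
  simp only [Matrix.updateRow_apply]
  split_ifs
  · exact const _
  · exact hM _ _

omit [DecidableEq m] in
theorem matrix_mul {M : (σ → ℂ) → Matrix m' m ℂ} {N : (σ → ℂ) → Matrix m m'' ℂ}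
    (hM : ∀ i j, IsPoly fun v => M v i j) (hN : ∀ i j, IsPoly fun v => N v i j) (i : m') (j : m'') :
    IsPoly fun v => (M v * N v) i j := by
  simp only [Matrix.mul_apply]
  exact sum _ fun a _ => (hM _ _).mul (hN _ _)

end IsPoly

/-! ## Matrices -/

theorem linearIndependent_of_det_mul_ne_zero {m p : Type} [Fintype m] [DecidableEq m] [Fintype p]
    {A : Matrix m p ℂ} {L : Matrix p m ℂ} (h : (A * L).det ≠ 0) : LinearIndependent ℂ A.row := by
  have h1 : Function.Injective fun v => Matrix.vecMul v (A * L) :=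
    Matrix.vecMul_injective_of_isUnit ((Matrix.isUnit_iff_isUnit_det _).2 (isUnit_iff_ne_zero.2 h))
  refine (Matrix.vecMul_injective_iff (M := A)).1 fun x y hxy => h1 ?_
  simp only [← Matrix.vecMul_vecMul] at hxy ⊢
  rw [hxy]

theorem exists_mul_eq_one_of_linearIndependent {m p : Type} [Fintype m] [DecidableEq m]
    [Fintype p] {A : Matrix m p ℂ} (h : LinearIndependent ℂ A.row) :
    ∃ L : Matrix p m ℂ, A * L = 1 := by
  classical
  have h1 : Function.Injective A.vecMulLinear := (Matrix.vecMul_injective_iff (M := A)).2 h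
  obtain ⟨g, hg⟩ := A.vecMulLinear.exists_leftInverse_of_injective (LinearMap.ker_eq_bot.2 h1)
  have h2 : ∀ x, Matrix.vecMul x (LinearMap.toMatrixRight' g) = g x := fun x => by
    conv_rhs => rw [← LinearMap.toMatrixRight'.symm_apply_apply g]
    rfl
  refine ⟨LinearMap.toMatrixRight' g, ?_⟩
  ext i j
  have h3 := congrFun (LinearMap.congr_fun hg (Pi.single i 1)) j
  simp only [LinearMap.comp_apply, ← h2, Matrix.vecMulLinear_apply,
    Matrix.single_one_vecMul, LinearMap.id_apply] at h3
  rw [Matrix.one_apply, ← Matrix.row_apply (A * _) i j]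
  refine h3.trans ?_
  rw [Pi.single_apply]
  simp only [eq_comm]

theorem exists_matrix_mul_eq {m p q : Type} [Fintype m] {A : Matrix m p ℂ} {B : Matrix q p ℂ}
    (h : ∀ i, B.row i ∈ Submodule.span ℂ (Set.range A.row)) : ∃ g : Matrix q m ℂ, B = g * A := by
  choose g hg using fun i => (Submodule.mem_span_range_iff_exists_fun ℂ).1 (h i)
  refine ⟨Matrix.of g, ?_⟩
  ext i j
  have h1 := congrFun (hg i) j
  rw [Matrix.mul_apply, ← Matrix.row_apply B, ← h1]
  simp

theorem matrix_mul_mem_span {m p q : Type} [Fintype m] (g : Matrix q m ℂ) (A : Matrix m p ℂ)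
    (i : q) : (g * A).row i ∈ Submodule.span ℂ (Set.range A.row) := by
  refine (Submodule.mem_span_range_iff_exists_fun ℂ).2 ⟨g.row i, ?_⟩
  ext j
  simp [Matrix.mul_apply]

theorem span_matrix_mul_eq {m p : Type} [Fintype m] [DecidableEq m] {g : Matrix m m ℂ}
    (hg : g.det ≠ 0) (A : Matrix m p ℂ) :
    Submodule.span ℂ (Set.range (g * A).row) = Submodule.span ℂ (Set.range A.row) := by
  refine le_antisymm (Submodule.span_le.2 ?_) (Submodule.span_le.2 ?_)
  · rintro _ ⟨i, rfl⟩
    exact matrix_mul_mem_span g A i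
  · rintro _ ⟨i, rfl⟩
    have h : g⁻¹ * (g * A) = A := Matrix.nonsing_inv_mul_cancel_left _ _ (isUnit_iff_ne_zero.2 hg)
    have h1 := matrix_mul_mem_span g⁻¹ (g * A) i
    rwa [h] at h1

theorem linearIndependent_matrix_mul {m p : Type} [Fintype m] [DecidableEq m] [Fintype p]
    {g : Matrix m m ℂ} (hg : g.det ≠ 0) {A : Matrix m p ℂ} (hA : LinearIndependent ℂ A.row) :
    LinearIndependent ℂ (g * A).row := by
  obtain ⟨L, hL⟩ := exists_mul_eq_one_of_linearIndependent hA
  exact linearIndependent_of_det_mul_ne_zero (L := L) (by rwa [Matrix.mul_assoc, hL, mul_one])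

theorem exists_det_ne_zero_of_span_eq {m p : Type} [Fintype m] [DecidableEq m] [Fintype p]
    {A B : Matrix m p ℂ} (_hA : LinearIndependent ℂ A.row) (hB : LinearIndependent ℂ B.row)
    (h : Submodule.span ℂ (Set.range A.row) = Submodule.span ℂ (Set.range B.row)) :
    ∃ g : Matrix m m ℂ, g.det ≠ 0 ∧ B = g * A := by
  obtain ⟨g, hg⟩ := exists_matrix_mul_eq (A := A) (B := B) fun i => by
    rw [h]
    exact Submodule.subset_span ⟨i, rfl⟩
  refine ⟨g, ?_, hg⟩
  obtain ⟨L, hL⟩ := exists_mul_eq_one_of_linearIndependent hB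
  rw [hg, Matrix.mul_assoc] at hL
  intro h0
  have := congrArg Matrix.det hL
  simp [Matrix.det_mul, h0] at this

/-- Linear independence is a Zariski open condition. -/
theorem exists_isPoly_linearIndependent {σ m p : Type} [Fintype m] [Fintype p]
    {w : (σ → ℂ) → Matrix m p ℂ} (hw : ∀ i j, IsPoly fun v => w v i j) {v₀ : σ → ℂ}
    (h : LinearIndependent ℂ (w v₀).row) :
    ∃ f, IsPoly f ∧ f v₀ ≠ 0 ∧ ∀ v, f v ≠ 0 → LinearIndependent ℂ (w v).row := by
  classical
  obtain ⟨L, hL⟩ := exists_mul_eq_one_of_linearIndependent h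
  refine ⟨fun v => (w v * L).det, IsPoly.det (IsPoly.matrix_mul hw fun i j => IsPoly.const _), ?_,
    fun v hv => linearIndependent_of_det_mul_ne_zero hv⟩
  simp [hL]

/-! ## Frames and the Zariski topology -/

/-- The Zariski topology on frames. -/
instance Frame.topologicalSpace (k n : ι → ℕ) : TopologicalSpace (Frame k n) :=
  TopologicalSpace.induced Frame.coords (zariskiAffine (Coord k n))

/-- Nonvanishing sets are stable under finite intersections, by multiplying the polynomials, so the
generating family is already a basis. -/
theorem isOpen_zariskiAffine_iff {σ : Type} {s : Set (σ → ℂ)} :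
    IsOpen[zariskiAffine σ] s ↔
      ∀ v ∈ s, ∃ f, IsPoly f ∧ f v ≠ 0 ∧ ∀ w, f w ≠ 0 → w ∈ s := by
  constructor
  · intro h
    induction h with
    | basic s hs =>
      obtain ⟨P, rfl⟩ := hs
      exact fun v hv => ⟨_, IsPoly.eval P, hv, fun w hw => hw⟩
    | univ => exact fun v _ => ⟨_, IsPoly.const 1, one_ne_zero, fun _ _ => trivial⟩
    | inter s t _ _ hs ht =>
      intro v hv
      obtain ⟨f, hf, hfv, hfs⟩ := hs v hv.1
      obtain ⟨g, hg, hgv, hgt⟩ := ht v hv.2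
      exact ⟨_, hf.mul hg, mul_ne_zero hfv hgv, fun w hw =>
        ⟨hfs w (left_ne_zero_of_mul hw), hgt w (right_ne_zero_of_mul hw)⟩⟩
    | sUnion S _ hS =>
      rintro v ⟨s, hs, hv⟩
      obtain ⟨f, hf, hfv, hfs⟩ := hS s hs v hv
      exact ⟨f, hf, hfv, fun w hw => ⟨s, hs, hfs w hw⟩⟩
  · intro h
    refine (@isOpen_iff_forall_mem_open _ (zariskiAffine σ) _).2 fun v hv => ?_
    obtain ⟨f, ⟨P, hP⟩, hfv, hfs⟩ := h v hv
    refine ⟨{w | MvPolynomial.eval w P ≠ 0}, fun w hw => hfs w (by rwa [hP]),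
      TopologicalSpace.isOpen_generateFrom_of_mem ⟨P, rfl⟩, ?_⟩
    change _ ≠ _
    rwa [← hP]

/-- The matrix with given coordinates, in the `a`-th factor. -/
def matOf (v : Coord k n → ℂ) (a : ι) : Matrix (Fin (k a)) (Fin (n a)) ℂ :=
  Matrix.of fun p q => v ⟨a, p, q⟩

/-- The matrix whose rows are the vectors of the `a`-th frame. -/
abbrev Frame.mat (A : Frame k n) (a : ι) : Matrix (Fin (k a)) (Fin (n a)) ℂ :=
  matOf A.coords a

theorem isPoly_matOf (a : ι) (p : Fin (k a)) (q : Fin (n a)) :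
    IsPoly fun v : Coord k n → ℂ => matOf v a p q := IsPoly.coord _

theorem Frame.linearIndependent_mat (A : Frame k n) (a : ι) : LinearIndependent ℂ (A.mat a).row :=
  A.2 a

/-- The frame with given matrices. -/
def Frame.ofMat (M : ∀ a, Matrix (Fin (k a)) (Fin (n a)) ℂ)
    (hM : ∀ a, LinearIndependent ℂ (M a).row) : Frame k n := ⟨fun a => (M a).row, hM⟩

theorem Frame.mat_ofMat (M : ∀ a, Matrix (Fin (k a)) (Fin (n a)) ℂ)
    (hM : ∀ a, LinearIndependent ℂ (M a).row) (a : ι) : (Frame.ofMat M hM).mat a = M a := rfl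

theorem Frame.isOpen_iff {S : Set (Frame k n)} :
    IsOpen S ↔ ∀ A ∈ S, ∃ f, IsPoly f ∧ f A.coords ≠ 0 ∧ ∀ B : Frame k n, f B.coords ≠ 0 → B ∈ S := by
  constructor
  · intro h A hA
    obtain ⟨t, ht, rfl⟩ := (@isOpen_induced_iff _ _ (zariskiAffine _) _ _).1 h
    obtain ⟨f, hf, hfv, hfs⟩ := isOpen_zariskiAffine_iff.1 ht A.coords hA
    exact ⟨f, hf, hfv, fun B hB => hfs _ hB⟩
  · intro h
    refine isOpen_iff_forall_mem_open.2 fun A hA => ?_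
    obtain ⟨f, hf, hfv, hfs⟩ := h A hA
    refine ⟨{B | f B.coords ≠ 0}, hfs, (@isOpen_induced_iff _ _ (zariskiAffine _) _ _).2 ⟨{v | f v ≠ 0}, ?_, rfl⟩, hfv⟩
    exact isOpen_zariskiAffine_iff.2 fun v hv => ⟨f, hf, hv, fun _ hw => hw⟩

theorem Frame.isOpen_ne_zero {f : (Coord k n → ℂ) → ℂ} (hf : IsPoly f) :
    IsOpen {A : Frame k n | f A.coords ≠ 0} :=
  Frame.isOpen_iff.2 fun _ hA => ⟨f, hf, hA, fun _ hB => hB⟩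

theorem Frame.toGr_surjective : Function.Surjective (Frame.toGr : Frame k n → MultiGr k n) := by
  intro V
  have b : ∀ a, Module.Basis (Fin (k a)) ℂ (V a).1 := fun a =>
    Module.finBasisOfFinrankEq ℂ _ (V a).2
  refine ⟨⟨fun a p => (b a p : Fin (n a) → ℂ), fun a => ?_⟩, ?_⟩
  · exact (b a).linearIndependent.map' (V a).1.subtype (Submodule.ker_subtype _)
  · funext a
    apply Subtype.ext
    have h := congrArg (Submodule.map (V a).1.subtype) (b a).span_eq
    rw [Submodule.map_span, Submodule.map_top, Submodule.range_subtype, ← Set.range_comp] at h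
    exact h

theorem isOpen_iff {S : Set (MultiGr k n)} : IsOpen S ↔ ∀ A : Frame k n, A.toGr ∈ S →
    ∃ f, IsPoly f ∧ f A.coords ≠ 0 ∧ ∀ B : Frame k n, f B.coords ≠ 0 → B.toGr ∈ S := by
  rw [isOpen_coinduced]
  exact Frame.isOpen_iff

theorem Frame.exists_of_toGr_eq {A B : Frame k n} (h : A.toGr = B.toGr) :
    ∃ g : ∀ a, Matrix (Fin (k a)) (Fin (k a)) ℂ, (∀ a, (g a).det ≠ 0) ∧
      ∀ a, B.mat a = g a * A.mat a := by
  have h1 := fun a => exists_det_ne_zero_of_span_eq (A.linearIndependent_mat a)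
    (B.linearIndependent_mat a) (congrArg Subtype.val (congrFun h a))
  choose g hg using h1
  exact ⟨g, fun a => (hg a).1, fun a => (hg a).2⟩

/-- The change of basis of a family of frames. -/
theorem Frame.exists_mat_eq_mul (A : Frame k n) (g : ∀ a, Matrix (Fin (k a)) (Fin (k a)) ℂ)
    (hg : ∀ a, (g a).det ≠ 0) :
    ∃ B : Frame k n, B.toGr = A.toGr ∧ ∀ a, B.mat a = g a * A.mat a :=
  ⟨Frame.ofMat (fun a => g a * A.mat a) fun a =>
      linearIndependent_matrix_mul (hg a) (A.linearIndependent_mat a),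
    funext fun a => Subtype.ext (span_matrix_mul_eq (hg a) _), fun _ => rfl⟩

/-- Two frames of the same point differ by invertible matrices, which act linearly on coordinates.
The saturation of an open set is therefore a union of open translates. -/
theorem Frame.isOpenMap_toGr : IsOpenMap (Frame.toGr : Frame k n → MultiGr k n) := by
  intro S hS
  refine SchubertResolution.isOpen_iff.2 ?_
  rintro A ⟨A', hA', hAA'⟩
  obtain ⟨f, hf, hfA, hfS⟩ := Frame.isOpen_iff.1 hS A' hA'
  obtain ⟨g, hg, hgA⟩ := Frame.exists_of_toGr_eq hAA'.symm
  let R : (Coord k n → ℂ) → Coord k n → ℂ := fun v s => (g s.1 * matOf v s.1) s.2.1 s.2.2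
  have hR : ∀ s, IsPoly fun v => R v s := fun s =>
    IsPoly.matrix_mul (M := fun _ => g s.1) (fun _ _ => IsPoly.const _) (isPoly_matOf _) _ _
  refine ⟨_, hf.comp hR, ?_, fun B hB => ?_⟩
  · convert hfA using 2
    funext s
    exact (congrFun (congrFun (hgA s.1) s.2.1) s.2.2).symm
  · obtain ⟨B', hB', hB'g⟩ := B.exists_mat_eq_mul g hg
    refine ⟨B', hfS _ ?_, hB'⟩
    convert hB using 2
    funext s
    exact congrFun (congrFun (hB'g s.1) s.2.1) s.2.2

theorem mem_nhds_of_isPoly {X : Set (MultiGr k n)} {S : Set X} {x : X} (A : Frame k n)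
    (hA : A.toGr = x.1) {f : (Coord k n → ℂ) → ℂ} (hf : IsPoly f) (hfA : f A.coords ≠ 0)
    (h : ∀ (B : Frame k n) (y : X), B.toGr = y.1 → f B.coords ≠ 0 → y ∈ S) : S ∈ 𝓝 x := by
  rw [nhds_subtype_eq_comap, Filter.mem_comap]
  refine ⟨Frame.toGr '' {B | f B.coords ≠ 0},
    (Frame.isOpenMap_toGr _ (Frame.isOpen_ne_zero hf)).mem_nhds ⟨A, hfA, hA⟩, ?_⟩
  rintro y ⟨B, hB, hBy⟩
  exact h B y hBy hB

theorem exists_isPoly_of_mem_nhds {X : Set (MultiGr k n)} {S : Set X} {x : X} (h : S ∈ 𝓝 x)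
    (A : Frame k n) (hA : A.toGr = x.1) :
    ∃ f, IsPoly f ∧ f A.coords ≠ 0 ∧
      ∀ (B : Frame k n) (y : X), B.toGr = y.1 → f B.coords ≠ 0 → y ∈ S := by
  rw [nhds_subtype_eq_comap, Filter.mem_comap] at h
  obtain ⟨T, hT, hTS⟩ := h
  obtain ⟨U, hUT, hU, hxU⟩ := mem_nhds_iff.1 hT
  obtain ⟨f, hf, hfA, hfU⟩ := isOpen_iff.1 hU A (hA ▸ hxU)
  exact ⟨f, hf, hfA, fun B y hB hfB => hTS (hUT (hB ▸ hfU B hfB))⟩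

/-! ## Regular functions and morphisms -/

theorem regularAt_iff {X : Set (MultiGr k n)} {f : X → ℂ} {x : X} :
    RegularAt f x ↔ ∀ A : Frame k n, A.toGr = x.1 → ∃ p q : (Coord k n → ℂ) → ℂ,
      IsPoly p ∧ IsPoly q ∧ q A.coords ≠ 0 ∧ ∀ (B : Frame k n) (y : X), B.toGr = y.1 →
        q B.coords ≠ 0 → f y = p B.coords / q B.coords := by
  refine forall₂_congr fun A _ => ⟨?_, ?_⟩
  · rintro ⟨P, Q, hQ, h⟩
    exact ⟨_, _, IsPoly.eval P, IsPoly.eval Q, hQ, h⟩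
  · rintro ⟨p, q, ⟨P, hP⟩, ⟨Q, hQ⟩, hqA, h⟩
    refine ⟨P, Q, hQ _ ▸ hqA, fun B y hB hne => ?_⟩
    rw [← hP, ← hQ]
    exact h B y hB (hQ _ ▸ hne)

/-- A map of varieties that can be lifted locally to polynomial maps of frames is a morphism. -/
theorem IsMorphism.of_lift {X : Set (MultiGr k n)} {Y : Set (MultiGr k' n')} {f : X → Y}
    (h : ∀ A : Frame k n, A.toGr ∈ X → ∃ (q : (Coord k n → ℂ) → ℂ)
      (R : (Coord k n → ℂ) → Coord k' n' → ℂ), IsPoly q ∧ (∀ s, IsPoly fun v => R v s) ∧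
      q A.coords ≠ 0 ∧ ∀ (B : Frame k n) (y : X), B.toGr = y.1 → q B.coords ≠ 0 →
        ∃ B' : Frame k' n', B'.toGr = (f y).1 ∧ B'.coords = R B.coords) :
    IsMorphism f where
  continuous := by
    refine continuous_iff_continuousAt.2 fun x S hS => ?_
    obtain ⟨A, hA⟩ := Frame.toGr_surjective x.1
    obtain ⟨q, R, hq, hR, hqA, hlift⟩ := h A (hA ▸ x.2)
    obtain ⟨A', hA', hA'R⟩ := hlift A x hA hqA
    obtain ⟨g, hg, hgA, hgS⟩ := exists_isPoly_of_mem_nhds hS A' hA'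
    refine mem_nhds_of_isPoly A hA (hq.mul (hg.comp hR)) (mul_ne_zero hqA (hA'R ▸ hgA))
      fun B y hB hne => ?_
    obtain ⟨B', hB', hB'R⟩ := hlift B y hB (left_ne_zero_of_mul hne)
    exact hgS B' _ hB' (hB'R ▸ right_ne_zero_of_mul hne)
  regular := by
    intro x g hg
    rw [regularAt_iff] at hg ⊢
    intro A hA
    obtain ⟨q, R, hq, hR, hqA, hlift⟩ := h A (hA ▸ x.2)
    obtain ⟨A', hA', hA'R⟩ := hlift A x hA hqA
    obtain ⟨P, Q, hP, hQ, hQA, hPQ⟩ := hg A' hA'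
    refine ⟨_, _, (hP.comp hR).mul hq, (hQ.comp hR).mul hq, mul_ne_zero (hA'R ▸ hQA) hqA,
      fun B y hB hne => ?_⟩
    obtain ⟨B', hB', hB'R⟩ := hlift B y hB (right_ne_zero_of_mul hne)
    rw [Function.comp_apply, hPQ B' _ hB' (hB'R ▸ left_ne_zero_of_mul hne), hB'R,
      mul_div_mul_right _ _ (right_ne_zero_of_mul hne)]

/-! ## Elimination -/

section Elimination

open MvPolynomial

theorem eval_smul_of_isHomogeneous {σ : Type} [Fintype σ] {F : MvPolynomial σ ℂ} {d : ℕ}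
    (hF : F.IsHomogeneous d) (c : ℂ) (x : σ → ℂ) : eval (c • x) F = c ^ d * eval x F := by
  rw [eval_eq', eval_eq', Finset.mul_sum]
  refine Finset.sum_congr rfl fun a ha => ?_
  have h : ∏ i, (c • x) i ^ a i = c ^ d * ∏ i, x i ^ a i := by
    simp only [Pi.smul_apply, smul_eq_mul, mul_pow, Finset.prod_mul_distrib,
      Finset.prod_pow_eq_pow_sum]
    rw [← Finsupp.degree_eq_sum, Finsupp.degree_apply, hF.degree_eq_sum_deg_support ha]
  rw [h]
  ring

/-- If a polynomial vanishes on a punctured line, so do its homogeneous components. -/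
theorem eval_homogeneousComponent_eq_zero {σ : Type} [Fintype σ] {F : MvPolynomial σ ℂ}
    {x : σ → ℂ} (h : ∀ c : ℂ, c ≠ 0 → eval (c • x) F = 0) (d : ℕ) :
    eval x (homogeneousComponent d F) = 0 := by
  -- This is `c ↦ F (c • x)` as a polynomial in `c`. It has infinitely many roots, so its
  -- coefficients, the values at `x` of the homogeneous components, vanish.
  let p : Polynomial ℂ := ∑ i ∈ Finset.range (F.totalDegree + 1),
    Polynomial.monomial i (eval x (homogeneousComponent i F))
  have hp : ∀ c : ℂ, p.eval c = eval (c • x) F := fun c => by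
    conv_rhs => rw [← sum_homogeneousComponent F]
    rw [Polynomial.eval_finsetSum, map_sum]
    refine Finset.sum_congr rfl fun i _ => ?_
    rw [eval_smul_of_isHomogeneous (homogeneousComponent_isHomogeneous i F),
      Polynomial.eval_monomial, mul_comm]
  have hp0 : p = 0 := by
    refine Polynomial.eq_zero_of_infinite_isRoot p (Set.Infinite.mono (s := {c : ℂ | c ≠ 0}) ?_ ?_)
    · exact fun c hc => (hp c).trans (h c hc)
    · exact (Set.finite_singleton (0 : ℂ)).infinite_compl
  by_cases hd : d < F.totalDegree + 1
  · have := congrArg (fun q => q.coeff d) hp0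
    simpa [p, Polynomial.finsetSum_coeff, Polynomial.coeff_monomial, hd] using this
  · rw [homogeneousComponent_eq_zero _ _ (by omega), map_zero]

/-- If an ideal of polynomials over `ℂ` has no zero but the origin, then it contains all monomials
of some positive degree. -/
theorem exists_monomial_mem_of_zero {σ : Type} [Fintype σ] (J : Ideal (MvPolynomial σ ℂ))
    (h : ∀ x : σ → ℂ, (∀ p ∈ J, eval x p = 0) → x = 0) :
    ∃ d, 0 < d ∧ ∀ a : σ →₀ ℕ, a.degree = d → monomial a 1 ∈ J := by
  have h1 : ∀ s : σ, ∃ N : ℕ, X s ^ N ∈ J := fun s => by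
    have h2 : (X s : MvPolynomial σ ℂ) ∈ J.radical := by
      -- Nullstellensatz: each variable vanishes on the zero locus, so it lies in the radical.
      rw [← vanishingIdeal_zeroLocus_eq_radical (K := ℂ), mem_vanishingIdeal_iff]
      intro x hx
      have := h x fun p hp => by simpa using hx p hp
      simp [this]
    exact h2
  choose N hN using h1
  -- In a degree above `∑ s, N s` some exponent reaches `N s`, by the pigeonhole principle.
  refine ⟨∑ s, N s + 1, by omega, fun a ha => ?_⟩
  obtain ⟨s, hs⟩ : ∃ s, N s ≤ a s := by
    by_contra! hlt
    have : ∑ s, a s ≤ ∑ s, N s := Finset.sum_le_sum fun s _ => (hlt s).le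
    rw [Finsupp.degree_eq_sum] at ha
    omega
  have h3 : (monomial a 1 : MvPolynomial σ ℂ) =
      monomial (a - Finsupp.single s (N s)) 1 * X s ^ N s := by
    rw [X_pow_eq_monomial, monomial_mul, one_mul, tsub_add_cancel_of_le]
    rwa [Finsupp.single_le_iff]
  rw [h3]
  exact J.mul_mem_left _ (hN s)

/-- The main theorem of elimination theory: if a family of homogeneous equations
has no nontrivial solution for one value of the parameters, then it has none for the values
of the parameters in a Zariski neighbourhood. -/
theorem exists_elimination {σ R : Type} [Fintype σ] [CommRing R] (H : Set (MvPolynomial σ R))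
    (hH : ∀ h ∈ H, ∃ d, h.IsHomogeneous d) (φ : R →+* ℂ) (hφ : Function.Surjective φ)
    (h0 : ∀ x : σ → ℂ, (∀ h ∈ H, eval x (map φ h) = 0) → x = 0) :
    ∃ g : R, φ g ≠ 0 ∧ ∀ ψ : R →+* ℂ, ψ g ≠ 0 →
      ∀ x : σ → ℂ, (∀ h ∈ H, eval x (map ψ h) = 0) → x = 0 := by
  classical
  obtain ⟨d, hd, hmon⟩ := exists_monomial_mem_of_zero (Ideal.map (map φ) (Ideal.span H))
    fun x hx => h0 x fun h hh => hx _ (Ideal.mem_map_of_mem _ (Ideal.subset_span hh))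
  -- The monomials of degree `d` lie in the specialized ideal; surjectivity of `φ` lifts them to the
  -- ideal over `R`.
  have h1 : ∀ a : {a : σ →₀ ℕ // a.degree = d}, ∃ F ∈ Ideal.span H, map φ F = monomial a.1 1 :=
    fun a => (Ideal.mem_map_iff_of_surjective _ (map_surjective φ hφ)).1 (hmon a.1 a.2)
  choose F hF hFφ using h1
  have : Finite {a : σ →₀ ℕ // a.degree = d} := Finsupp.finite_of_degree_eq d
  have := Fintype.ofFinite {a : σ →₀ ℕ // a.degree = d}
  -- The degree `d` coefficients of the lifts. At `φ` this is the identity matrix, so its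
  -- determinant is the function sought.
  let c : Matrix {a : σ →₀ ℕ // a.degree = d} {a : σ →₀ ℕ // a.degree = d} R :=
    Matrix.of fun a b => coeff b.1 (F a)
  refine ⟨c.det, ?_, fun ψ hψ x hx => ?_⟩
  · have h2 : φ.mapMatrix c = 1 := by
      ext a b
      simp [c, ← coeff_map, hFφ, coeff_monomial, Matrix.one_apply, Subtype.ext_iff]
    rw [RingHom.map_det, h2]
    simp
  · have h2 : ∀ G ∈ Ideal.span H, ∀ t : ℂ, eval (t • x) (map ψ G) = 0 := by
      intro G hG t
      induction hG using Submodule.span_induction with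
      | mem G hG =>
        obtain ⟨e, he⟩ := hH G hG
        rw [eval_smul_of_isHomogeneous (he.map ψ), hx G hG, mul_zero]
      | zero => simp
      | add G G' _ _ hG hG' => simp [hG, hG']
      | smul r G _ hG => simp [hG]
    -- The lifts need not be homogeneous, but they vanish on the whole line through `x`, hence so do
    -- their degree `d` parts. Invertibility of the matrix then kills all monomials of degree `d` at
    -- `x`, in particular the pure powers.
    have h3 : (ψ.mapMatrix c).mulVec (fun b => ∏ i, x i ^ b.1 i) = 0 := by
      funext a
      have h4 := eval_homogeneousComponent_eq_zero (fun t _ => h2 (F a) (hF a) t) d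
      rw [eval_eq'] at h4
      refine Eq.trans ?_ h4
      rw [support_homogeneousComponent]
      have h5 : ∀ b : σ →₀ ℕ, b.degree = d →
          coeff b (homogeneousComponent d (map ψ (F a))) = ψ (coeff b (F a)) := fun b hb => by
        rw [coeff_homogeneousComponent, if_pos hb, coeff_map]
      simp only [Matrix.mulVec, dotProduct]
      refine Finset.sum_bij_ne_zero (fun b _ _ => b.1) ?_ ?_ ?_ ?_
      · intro b _ hb
        simp only [Finset.mem_filter, mem_support_iff, coeff_map]
        exact ⟨left_ne_zero_of_mul hb, b.2⟩
      · intro b _ _ b' _ _ hbb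
        exact Subtype.ext hbb
      · intro b hb hne
        have hbd := (Finset.mem_filter.1 hb).2
        refine ⟨⟨b, hbd⟩, Finset.mem_univ _, ?_, rfl⟩
        rw [h5 b hbd] at hne
        exact hne
      · intro b _ _
        rw [h5 b.1 b.2]
        rfl
    have h6 : (ψ.mapMatrix c).det ≠ 0 := by rwa [← RingHom.map_det]
    have h7 := Matrix.eq_zero_of_mulVec_eq_zero h6 h3
    funext s
    have h8 := congrFun h7 ⟨Finsupp.single s d, by simp⟩
    simp only [Pi.zero_apply] at h8
    rw [Finset.prod_eq_zero_iff] at h8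
    obtain ⟨i, _, hi⟩ := h8
    by_cases his : s = i
    · subst his
      exact pow_eq_zero_iff (by simp; omega) |>.1 hi
    · simp [his] at hi

end Elimination

/-! ## Projections of closed sets -/

theorem det_updateRow_one {m : Type} [Fintype m] [DecidableEq m] (r : m) (u : m → ℂ) :
    ((1 : Matrix m m ℂ).updateRow r u).det = u r := by
  rw [← Matrix.cramer_transpose_apply, Matrix.transpose_one, Matrix.cramer_one]
  rfl

/-- The coordinates of one of the vectors of a frame. -/
def vecCoord {j : ι} (r : Fin (k j)) (q : Fin (n j)) : Coord k n := ⟨j, r, q⟩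

theorem vecCoord_injective {j : ι} (r : Fin (k j)) :
    Function.Injective (vecCoord r : Fin (n j) → Coord k n) := by
  intro q q' h
  simpa [vecCoord] using h

theorem mem_range_vecCoord {j : ι} {r : Fin (k j)} {s : Coord k n} :
    (∃ q, vecCoord r q = s) ↔ s.1 = j ∧ (s.2.1 : ℕ) = r := by
  constructor
  · rintro ⟨q, rfl⟩
    exact ⟨rfl, rfl⟩
  · obtain ⟨a, p, q⟩ := s
    rintro ⟨rfl, h⟩
    obtain rfl : p = r := Fin.ext h
    exact ⟨q, rfl⟩

/-- Replace one of the vectors of a frame. -/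
def replaceVec {j : ι} (r : Fin (k j)) (v : Coord k n → ℂ) (x : Fin (n j) → ℂ) : Coord k n → ℂ :=
  Function.extend (vecCoord r) x v

theorem replaceVec_vecCoord {j : ι} (r : Fin (k j)) (v : Coord k n → ℂ) (x : Fin (n j) → ℂ)
    (q : Fin (n j)) : replaceVec r v x (vecCoord r q) = x q :=
  (vecCoord_injective r).extend_apply _ _ _

theorem replaceVec_of_ne {j : ι} {r : Fin (k j)} (v : Coord k n → ℂ) (x : Fin (n j) → ℂ)
    {s : Coord k n} (hs : ¬ (s.1 = j ∧ (s.2.1 : ℕ) = r)) : replaceVec r v x s = v s :=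
  Function.extend_apply' _ _ _ (mt mem_range_vecCoord.1 hs)

/-- The change of basis is the identity matrix with row `r` replaced by `u`; its determinant is `u
r`. -/
theorem Frame.exists_coords_eq_replaceVec (A : Frame k n) {j : ι} (r : Fin (k j))
    (u : Fin (k j) → ℂ) (hu : u r ≠ 0) :
    ∃ B : Frame k n, B.toGr = A.toGr ∧
      B.coords = replaceVec r A.coords (Matrix.vecMul u (A.mat j)) := by
  classical
  obtain ⟨B, hB, hBA⟩ := A.exists_mat_eq_mul
    (Function.update (fun a => 1) j ((1 : Matrix _ _ ℂ).updateRow r u)) fun a => by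
      by_cases ha : a = j
      · subst ha
        simpa [det_updateRow_one] using hu
      · simp [Function.update_of_ne ha]
  refine ⟨B, hB, ?_⟩
  funext s
  by_cases hs : s.1 = j ∧ (s.2.1 : ℕ) = r
  · obtain ⟨q, rfl⟩ := mem_range_vecCoord.2 hs
    rw [replaceVec_vecCoord]
    have h := congrFun (congrArg (fun M => M.row r) (hBA j)) q
    rw [Function.update_self, Matrix.updateRow_mul] at h
    exact h.trans (by simp)
  · rw [replaceVec_of_ne _ _ hs]
    obtain ⟨a, p, q⟩ := s
    have h := congrFun (congrArg (fun M => M.row p) (hBA a)) q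
    by_cases ha : a = j
    · subst ha
      have hp : p ≠ r := fun h => hs ⟨rfl, by simp [h]⟩
      rw [Function.update_self, Matrix.updateRow_mul, Matrix.one_mul] at h
      exact h.trans (congrFun (Matrix.updateRow_ne hp) q)
    · rw [Function.update_of_ne ha, Matrix.one_mul] at h
      exact h

/-- Points of the affine space that agree with some frame of an element of `C`, except for the
vectors with index at least `r` of the `j`-th frame. -/
def partialFrames (C : Set (MultiGr k n)) (j : ι) (r : ℕ) : Set (Coord k n → ℂ) :=
  {v | ∃ A : Frame k n, A.toGr ∈ C ∧ ∀ s, (s.1 = j → (s.2.1 : ℕ) < r) → A.coords s = v s}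

/-- Points of the affine space that consist of linearly independent tuples, except for the vectors
with index at least `r` of the `j`-th tuple. -/
def partialIndep (k n : ι → ℕ) (j : ι) (r : ℕ) : Set (Coord k n → ℂ) :=
  {v | (∀ a ≠ j, LinearIndependent ℂ (matOf v a).row) ∧
    LinearIndepOn ℂ (matOf v j).row {p | (p : ℕ) < r}}

/-- Substitute new variables for the coordinates of one of the vectors. -/
def replaceVecPoly {j : ι} (r : Fin (k j)) (P : MvPolynomial (Coord k n) ℂ) :
    MvPolynomial (Fin (n j)) (MvPolynomial (Coord k n) ℂ) :=
  MvPolynomial.eval₂ (MvPolynomial.C.comp MvPolynomial.C) (Function.extend (vecCoord r)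
    MvPolynomial.X fun s => MvPolynomial.C (MvPolynomial.X s)) P

theorem eval_replaceVecPoly {j : ι} (r : Fin (k j)) (P : MvPolynomial (Coord k n) ℂ)
    (v : Coord k n → ℂ) (x : Fin (n j) → ℂ) :
    MvPolynomial.eval x (MvPolynomial.map (MvPolynomial.eval v) (replaceVecPoly r P)) =
      MvPolynomial.eval (replaceVec r v x) P := by
  induction P using MvPolynomial.induction_on with
  | C a => simp [replaceVecPoly]
  | add p q hp hq =>
    simp only [replaceVecPoly, MvPolynomial.eval₂_add, map_add] at hp hq ⊢
    rw [hp, hq]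
  | mul_X p s hp =>
    simp only [replaceVecPoly, MvPolynomial.eval₂_mul, map_mul, MvPolynomial.eval₂_X] at hp ⊢
    rw [hp, MvPolynomial.eval_X]
    congr 1
    by_cases hs : ∃ q, vecCoord r q = s
    · obtain ⟨q, rfl⟩ := hs
      rw [(vecCoord_injective r).extend_apply, replaceVec_vecCoord]
      simp
    · rw [Function.extend_apply' _ _ _ hs, replaceVec, Function.extend_apply' _ _ _ hs]
      simp

theorem map_homogeneousComponent {σ R S : Type} [CommRing R] [CommRing S] (φ : R →+* S) (d : ℕ)
    (F : MvPolynomial σ R) : MvPolynomial.map φ (MvPolynomial.homogeneousComponent d F) =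
      MvPolynomial.homogeneousComponent d (MvPolynomial.map φ F) := by
  classical
  ext a
  simp only [MvPolynomial.coeff_map, MvPolynomial.coeff_homogeneousComponent]
  split_ifs <;> simp

/-- Rescaling one vector of a frame keeps all spans. This cone property is what makes the equations
in the new vector homogeneous. -/
theorem replaceVec_smul_mem_partialFrames {C : Set (MultiGr k n)} {j : ι} {r : Fin (k j)}
    {v : Coord k n → ℂ} {x : Fin (n j) → ℂ} (h : replaceVec r v x ∈ partialFrames C j (r + 1))
    {c : ℂ} (hc : c ≠ 0) : replaceVec r v (c • x) ∈ partialFrames C j (r + 1) := by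
  obtain ⟨A, hA, hAx⟩ := h
  obtain ⟨B, hB, hBA⟩ := A.exists_coords_eq_replaceVec r (Pi.single r c) (by simpa using hc)
  refine ⟨B, hB ▸ hA, fun s hs => ?_⟩
  rw [hBA]
  by_cases hsr : s.1 = j ∧ (s.2.1 : ℕ) = r
  · obtain ⟨q, rfl⟩ := mem_range_vecCoord.2 hsr
    have h1 := hAx _ hs
    rw [replaceVec_vecCoord] at h1 ⊢
    rw [replaceVec_vecCoord, Pi.smul_apply, ← h1]
    simp [Matrix.single_vecMul, matOf, vecCoord]
  · have h1 := hAx _ hs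
    rw [replaceVec_of_ne _ _ hsr] at h1 ⊢
    rw [h1, replaceVec_of_ne _ _ hsr]

/-- The first `r` rows of the `j`-th matrix. -/
def firstRows (v : Coord k n → ℂ) (j : ι) (r : ℕ) :
    Matrix {p : Fin (k j) // (p : ℕ) < r} (Fin (n j)) ℂ :=
  (matOf v j).submatrix Subtype.val id

/-- The `r`-th vector of a completing frame may be corrected by the earlier ones. As `L` is
invertible on their span, exactly one correction is killed by `L`, and it is nonzero by
independence. -/
theorem exists_replaceVec_mem_partialFrames {C : Set (MultiGr k n)} {j : ι} (r : Fin (k j))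
    {v : Coord k n → ℂ} (h : v ∈ partialFrames C j r)
    {L : Matrix (Fin (n j)) {p : Fin (k j) // (p : ℕ) < r} ℂ} (hL : (firstRows v j r * L).det ≠ 0) :
    ∃ x, x ≠ 0 ∧ Matrix.vecMul x L = 0 ∧ replaceVec r v x ∈ partialFrames C j (r + 1) := by
  obtain ⟨A, hA, hAv⟩ := h
  let S : Matrix {p : Fin (k j) // (p : ℕ) < r} (Fin (k j)) ℂ :=
    (1 : Matrix _ _ ℂ).submatrix Subtype.val id
  have hS : S * A.mat j = firstRows v j r := by
    ext p q
    have h1 : (S * A.mat j) p q = A.mat j p.1 q := by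
      simp [S, Matrix.mul_apply, Matrix.one_apply]
    rw [h1]
    exact hAv _ fun _ => p.2
  let c := Matrix.vecMul (Matrix.vecMul ((A.mat j).row r) L) (firstRows v j r * L)⁻¹
  let u : Fin (k j) → ℂ := Pi.single r 1 - Matrix.vecMul c S
  have hur : u r = 1 := by
    have h2 : Matrix.vecMul c S r = 0 := by
      simp only [Matrix.vecMul, dotProduct]
      refine Finset.sum_eq_zero fun p _ => ?_
      have : p.1 ≠ r := fun h => (h ▸ p.2).ne rfl
      simp [S, this]
    simp only [u, Pi.sub_apply, h2]
    simp
  obtain ⟨B, hB, hBA⟩ := A.exists_coords_eq_replaceVec r u (by simp [hur])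
  refine ⟨Matrix.vecMul u (A.mat j), fun h0 => ?_, ?_, B, hB ▸ hA, fun s hs => ?_⟩
  · have h3 : Function.Injective (A.mat j).vecMul :=
      Matrix.vecMul_injective_iff.2 (A.linearIndependent_mat j)
    have h4 : u = 0 := h3 (by simpa using h0)
    simp [h4] at hur
  · rw [Matrix.sub_vecMul, Matrix.vecMul_vecMul, hS, Matrix.sub_vecMul, Matrix.vecMul_vecMul,
      Matrix.vecMul_vecMul c]
    simp only [c]
    rw [Matrix.vecMul_vecMul _ (_)⁻¹, Matrix.nonsing_inv_mul _ (isUnit_iff_ne_zero.2 hL), Matrix.vecMul_one,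
      ← Matrix.vecMul_vecMul, Matrix.single_one_vecMul]
    exact sub_self _
  · rw [hBA]
    by_cases hsr : s.1 = j ∧ (s.2.1 : ℕ) = r
    · obtain ⟨q, rfl⟩ := mem_range_vecCoord.2 hsr
      rw [replaceVec_vecCoord, replaceVec_vecCoord]
    · rw [replaceVec_of_ne _ _ hsr, replaceVec_of_ne _ _ hsr]
      exact hAv s fun h => lt_of_le_of_ne (Nat.lt_succ_iff.1 (hs h)) fun h' => hsr ⟨h, h'⟩

/-- On the span of the first `r` rows `L` is injective, so a nonzero vector killed by `L` lies
outside that span. -/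
theorem replaceVec_mem_partialIndep {j : ι} {r : Fin (k j)} {v : Coord k n → ℂ}
    (hv : v ∈ partialIndep k n j r) {L : Matrix (Fin (n j)) {p : Fin (k j) // (p : ℕ) < r} ℂ}
    (hL : firstRows v j r * L = 1) {x : Fin (n j) → ℂ} (hx : x ≠ 0)
    (hxL : Matrix.vecMul x L = 0) : replaceVec r v x ∈ partialIndep k n j (r + 1) := by
  have h1 : ∀ p ≠ r, (matOf (replaceVec r v x) j).row p = (matOf v j).row p := fun p hp => by
    funext q
    exact replaceVec_of_ne v x fun h => hp (Fin.ext h.2)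
  refine ⟨fun a ha => ?_, ?_⟩
  · convert hv.1 a ha using 1
    funext p q
    exact replaceVec_of_ne v x fun h => ha h.1
  · have h2 : {p : Fin (k j) | (p : ℕ) < r + 1} =
        insert r {p : Fin (k j) | (p : ℕ) < r} := by
      ext p
      simp only [Set.mem_ofPred_eq, Set.mem_insert_iff, Fin.ext_iff]
      omega
    have h3 : Set.EqOn (matOf (replaceVec r v x) j).row (matOf v j).row {p : Fin (k j) | (p : ℕ) < r} :=
      fun p hp => h1 p fun h => (h ▸ hp : (r : ℕ) < r).ne rfl
    rw [h2, linearIndepOn_insert (by simp), linearIndepOn_congr h3, Set.image_congr h3]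
    refine ⟨hv.2, fun hmem => hx ?_⟩
    have h4 : (matOf (replaceVec r v x) j).row r = x := funext fun q => replaceVec_vecCoord r v x q
    have h5 : (matOf v j).row '' {p : Fin (k j) | (p : ℕ) < r} = Set.range (firstRows v j r).row := by
      rw [Set.image_eq_range]
      rfl
    rw [h4, h5] at hmem
    obtain ⟨g, hg⟩ := exists_matrix_mul_eq (A := firstRows v j r)
      (B := Matrix.of fun _ : Unit => x) fun _ => hmem
    have h6 : (Matrix.of fun _ : Unit => x) * L = 0 := by
      ext _ p
      exact congrFun hxL p
    rw [hg, Matrix.mul_assoc, hL, Matrix.mul_one] at h6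
    rw [h6, Matrix.zero_mul] at hg
    funext q
    exact congrFun (congrFun hg ()) q

/-- The set of partial frames that come from a closed set is closed in the set of all partial
frames. -/
theorem exists_isPoly_of_notMem_partialFrames {C : Set (MultiGr k n)} (hC : IsClosed C) (j : ι)
    {r : ℕ} (hr : r ≤ k j) {v : Coord k n → ℂ} (hv : v ∈ partialIndep k n j r)
    (hvC : v ∉ partialFrames C j r) :
    ∃ f, IsPoly f ∧ f v ≠ 0 ∧ ∀ w ∈ partialFrames C j r, f w = 0 := by
  classical
  -- Induction on the number of missing vectors. With none missing, `v` is a frame and closedness of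
  -- `C` applies.
  induction hd : k j - r generalizing r v with
  | zero =>
    obtain rfl : r = k j := by omega
    have hind : ∀ a, LinearIndependent ℂ (matOf v a).row := fun a => by
      by_cases ha : a = j
      · subst ha
        have h := hv.2
        rwa [show {p : Fin (k a) | (p : ℕ) < k a} = Set.univ by ext; simp,
          linearIndepOn_univ_iff] at h
      · exact hv.1 a ha
    have hA : (Frame.ofMat (matOf v) hind).toGr ∉ C := fun h => hvC ⟨_, h, fun s _ => rfl⟩
    obtain ⟨f, hf, hfv, hfC⟩ := isOpen_iff.1 hC.isOpen_compl _ hA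
    refine ⟨f, hf, hfv, ?_⟩
    rintro w ⟨A, hAC, hAw⟩
    have hAw' : A.coords = w := funext fun s => hAw s fun h => by
      obtain ⟨a, p, q⟩ := s
      simp only at h
      subst h
      exact p.2
    subst hAw'
    by_contra hne
    exact hfC A hne hAC
  | succ d ih =>
    have hrk : r < k j := by omega
    obtain ⟨r, rfl⟩ : ∃ r' : Fin (k j), r = r' := ⟨⟨r, hrk⟩, rfl⟩
    have hfirst : LinearIndependent ℂ (firstRows v j r).row := hv.2
    obtain ⟨L, hL⟩ := exists_mul_eq_one_of_linearIndependent hfirst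
    -- All homogeneous equations satisfied by a next vector `x` that extends `w` towards `C`. The
    -- normalization `vecMul x L = 0` excludes the useless solutions in the span of the vectors
    -- already present.
    let H : Set (MvPolynomial (Fin (n j)) (MvPolynomial (Coord k n) ℂ)) :=
      {h | (∃ d, h.IsHomogeneous d) ∧ ∀ w x, Matrix.vecMul x L = 0 →
        replaceVec r w x ∈ partialFrames C j (r + 1) →
          MvPolynomial.eval x (MvPolynomial.map (MvPolynomial.eval w) h) = 0}
    -- A nonzero common zero over `v` would be killed by `L`, since these linear forms belong to
    -- `H`, so it would extend `v` to a longer independent tuple, still not coming from `C`. The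
    -- polynomial given by induction has its homogeneous components in `x` in `H`, yet it does not
    -- vanish there.
    have hzero : ∀ x : Fin (n j) → ℂ, (∀ h ∈ H,
        MvPolynomial.eval x (MvPolynomial.map (MvPolynomial.eval v) h) = 0) → x = 0 := by
      intro x hx
      by_contra hx0
      have hxL : Matrix.vecMul x L = 0 := by
        have hlin : ∀ p w y, MvPolynomial.eval y (MvPolynomial.map (MvPolynomial.eval w)
            (∑ q, MvPolynomial.C (MvPolynomial.C (L q p)) * MvPolynomial.X q :
              MvPolynomial (Fin (n j)) (MvPolynomial (Coord k n) ℂ))) = Matrix.vecMul y L p := by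
          intro p w y
          simp [Matrix.vecMul, dotProduct, mul_comm]
        funext p
        rw [← hlin p v x]
        refine hx _ ⟨⟨1, MvPolynomial.IsHomogeneous.sum _ _ _ fun q _ =>
          MvPolynomial.isHomogeneous_C_mul_X _ _⟩, fun w y hy _ => ?_⟩
        rw [hlin, hy]
        rfl
      have hnot : replaceVec r v x ∉ partialFrames C j (r + 1) := by
        rintro ⟨A, hA, hAx⟩
        refine hvC ⟨A, hA, fun s hs => ?_⟩
        rw [hAx s fun h => (hs h).trans (Nat.lt_succ_self _),
          replaceVec_of_ne _ _ fun h => (hs h.1).ne h.2]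
      obtain ⟨f, ⟨P, hP⟩, hfx, hfC⟩ := ih hrk (replaceVec_mem_partialIndep hv hL hx0 hxL) hnot
        (by omega)
      refine hfx ?_
      rw [hP, ← eval_replaceVecPoly, ← MvPolynomial.sum_homogeneousComponent (replaceVecPoly r P),
        map_sum, map_sum]
      refine Finset.sum_eq_zero fun d _ => hx _
        ⟨⟨d, MvPolynomial.homogeneousComponent_isHomogeneous _ _⟩, fun w y _ hwy => ?_⟩
      rw [map_homogeneousComponent]
      refine eval_homogeneousComponent_eq_zero (fun c hc => ?_) d
      rw [eval_replaceVecPoly, ← hP]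
      exact hfC _ (replaceVec_smul_mem_partialFrames hwy hc)
    obtain ⟨g, hgv, hg⟩ := exists_elimination H (fun h hh => hh.1) (MvPolynomial.eval v)
      (fun c => ⟨MvPolynomial.C c, by simp⟩) hzero
    have hpoly : IsPoly fun w : Coord k n → ℂ => (firstRows w j r * L).det :=
      IsPoly.det (IsPoly.matrix_mul (fun p q => isPoly_matOf j p.1 q) fun _ _ => IsPoly.const _)
    have hne : (firstRows v j r * L).det * MvPolynomial.eval v g ≠ 0 := by
      rw [hL, Matrix.det_one, one_mul]
      exact hgv
    refine ⟨_, hpoly.mul (IsPoly.eval g), hne, fun w hw => ?_⟩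
    by_contra hne
    obtain ⟨x, hx0, hxL, hxC⟩ :=
      exists_replaceVec_mem_partialFrames r hw (left_ne_zero_of_mul hne)
    exact hx0 (hg _ (right_ne_zero_of_mul hne) x fun h hh => hh.2 w x hxL hxC)

/-- Forgetting one of the spaces is a closed map: Grassmannians are complete. -/
theorem isClosed_forget_one {C : Set (MultiGr k n)} (hC : IsClosed C) (j : ι) :
    IsClosed {V : MultiGr k n | ∃ W ∈ C, ∀ a ≠ j, W a = V a} := by
  classical
  refine ⟨isOpen_iff.2 fun A hA => ?_⟩
  -- With `r = 0` no vector of the `j`-th frame is prescribed, so this is membership in the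
  -- projection of `C`.
  have h0 : A.coords ∉ partialFrames C j 0 := by
    rintro ⟨B, hB, hBA⟩
    refine hA ⟨_, hB, fun a ha => ?_⟩
    have : B.1 a = A.1 a := funext fun p => funext fun q => hBA ⟨a, p, q⟩ fun h => (ha h).elim
    exact Subtype.ext (by simp [Frame.toGr, this])
  obtain ⟨f, hf, hfA, hfC⟩ := exists_isPoly_of_notMem_partialFrames hC j (Nat.zero_le _)
    ⟨fun a _ => A.linearIndependent_mat a, by simp⟩ h0
  refine ⟨f, hf, hfA, fun B hB => ?_⟩
  rintro ⟨W, hW, hWB⟩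
  obtain ⟨B', rfl⟩ := Frame.toGr_surjective W
  refine hB (hfC _ ⟨⟨Function.update B.1 j (B'.1 j), fun a => ?_⟩, ?_, ?_⟩)
  · by_cases ha : a = j
    · subst ha
      simpa using B'.2 a
    · simpa [Function.update_of_ne ha] using B.2 a
  · convert hW
    funext a
    by_cases ha : a = j
    · subst ha
      exact Subtype.ext (by simp [Frame.toGr])
    · rw [hWB a ha]
      exact Subtype.ext (by simp [Frame.toGr, Function.update_of_ne ha])
  · rintro ⟨a, p, q⟩ hs
    have ha : a ≠ j := fun h => by simpa using hs h
    simp [Frame.coords, Function.update_of_ne ha]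

theorem isClosed_forget {C : Set (MultiGr k n)} (hC : IsClosed C) (s : Finset ι) :
    IsClosed {V : MultiGr k n | ∃ W ∈ C, ∀ a ∉ s, W a = V a} := by
  classical
  induction s using Finset.induction_on with
  | empty =>
    convert hC
    ext V
    constructor
    · rintro ⟨W, hW, h⟩
      rwa [← funext fun a => h a (by simp)]
    · exact fun h => ⟨V, h, fun _ _ => rfl⟩
  | insert j s hj ih =>
    refine Eq.mp (congrArg IsClosed (Set.ext fun V => ⟨?_, ?_⟩)) (isClosed_forget_one ih j)
    · rintro ⟨V', ⟨W, hW, h⟩, h'⟩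
      refine ⟨W, hW, fun a ha => ?_⟩
      simp only [Finset.mem_insert, not_or] at ha
      rw [h a ha.2, h' a ha.1]
    · rintro ⟨W, hW, h⟩
      refine ⟨fun a => if a = j then W a else V a, ⟨W, hW, fun a ha => ?_⟩, fun a ha => if_neg ha⟩
      by_cases haj : a = j
      · simp [haj]
      · simp [haj, h a (by simp [haj, ha])]

/-! ## Local rings -/

theorem RegularAt.eventually_ne_zero {X : Set (MultiGr k n)} {f : X → ℂ} {x : X}
    (hf : RegularAt f x) (hx : f x ≠ 0) : ∀ᶠ y in 𝓝 x, f y ≠ 0 := by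
  obtain ⟨A, hA⟩ := Frame.toGr_surjective x.1
  obtain ⟨p, q, hp, hq, hqA, h⟩ := regularAt_iff.1 hf A hA
  have hpA : p A.coords ≠ 0 := fun h0 => hx (by rw [h A x hA hqA, h0, zero_div])
  refine mem_nhds_of_isPoly A hA (hp.mul hq) (mul_ne_zero hpA hqA) fun B y hB hne => ?_
  have hqB := right_ne_zero_of_mul hne
  exact (h B y hB hqB).trans_ne (div_ne_zero (left_ne_zero_of_mul hne) hqB)

theorem RegularAt.inv {X : Set (MultiGr k n)} {f : X → ℂ} {x : X}
    (hf : RegularAt f x) (hx : f x ≠ 0) : RegularAt f⁻¹ x := by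
  rw [regularAt_iff] at hf ⊢
  intro A hA
  obtain ⟨p, q, hp, hq, hqA, h⟩ := hf A hA
  have hpA : p A.coords ≠ 0 := fun h0 => hx (by rw [h A x hA hqA, h0, zero_div])
  refine ⟨_, _, hq.mul hq, hp.mul hq, mul_ne_zero hpA hqA, fun B y hB hne => ?_⟩
  rw [Pi.inv_apply, h B y hB (right_ne_zero_of_mul hne), inv_div,
    mul_div_mul_right _ _ (right_ne_zero_of_mul hne)]

theorem RegularAt.eval {X : Set (MultiGr k n)} {x : X} {τ : Type} {c : X → τ → ℂ}
    (hc : ∀ i, RegularAt (fun y => c y i) x) (P : MvPolynomial τ ℂ) :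
    RegularAt (fun y => MvPolynomial.eval (c y) P) x := by
  induction P using MvPolynomial.induction_on with
  | C a => simpa using RegularAt.const a x
  | add p q hp hq => simpa only [map_add] using! hp.add hq
  | mul_X p i hp => simpa only [map_mul, MvPolynomial.eval_X] using! hp.mul (hc i)

/-- The pull-back of polynomials to the local ring along a regular map to an affine space. -/
def pullback {X : Set (MultiGr k n)} {x : X} {τ : Type} {c : X → τ → ℂ}
    (hc : ∀ i, RegularAt (fun y => c y i) x) : MvPolynomial τ ℂ →+* localRing X x where
  toFun P := ⟨((fun y => MvPolynomial.eval (c y) P : X → ℂ) : Filter.Germ (𝓝 x) ℂ),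
    _, RegularAt.eval hc P, rfl⟩
  map_one' := Subtype.ext (by simp only [map_one]; rfl)
  map_zero' := Subtype.ext (by simp only [map_zero]; rfl)
  map_mul' P Q := Subtype.ext (by simp only [map_mul]; rfl)
  map_add' P Q := Subtype.ext (by simp only [map_add]; rfl)

/-- If a variety has a chart at `x`, that is, if it is isomorphic to an open subset of an affine
space in a neighbourhood of `x`, then its local ring at `x` is regular. -/
theorem isRegularLocalRing_of_chart {X : Set (MultiGr k n)} (x : X) {τ : Type} [Finite τ]
    (c : X → τ → ℂ) (hc : ∀ i, RegularAt (fun y => c y i) x) (σ : (τ → ℂ) → Coord k n → ℂ)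
    (hσ : ∀ s, IsPoly fun t => σ t s)
    (hleft : ∀ᶠ y in 𝓝 x, ∃ B : Frame k n, B.toGr = y.1 ∧ B.coords = σ (c y))
    (D : (τ → ℂ) → ℂ) (hD : IsPoly D) (hDx : D (c x) ≠ 0)
    (hright : ∀ t, D t ≠ 0 → ∃ (y : X) (B : Frame k n), B.toGr = y.1 ∧ B.coords = σ t ∧ c y = t) :
    IsRegularLocalRing (localRing X x) := by
  let m : Ideal (MvPolynomial τ ℂ) := RingHom.ker (MvPolynomial.eval (c x))
  have hm : m.IsPrime := RingHom.ker_isPrime _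
  algebraize [pullback hc]
  obtain ⟨A, hA, hAσ⟩ := hleft.self_of_nhds
  -- The local ring is the localization of the polynomial ring at the maximal ideal of `c x`: a
  -- quotient of polynomials in frame coordinates becomes one in chart coordinates by composition
  -- with `σ`.
  have hloc : IsLocalization.AtPrime (localRing X x) m :=
    { map_units := by
        rintro ⟨P, hP⟩
        have hP' : MvPolynomial.eval (c x) P ≠ 0 := hP
        have hreg := RegularAt.eval hc P
        refine IsUnit.of_mul_eq_one ⟨_, _, hreg.inv hP', rfl⟩ (Subtype.ext ?_)
        refine Filter.Germ.coe_eq.2 ((hreg.eventually_ne_zero hP').mono fun y hy => ?_)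
        exact mul_inv_cancel₀ hy
      surj := by
        rintro ⟨_, f, hf, rfl⟩
        obtain ⟨p, q, hp, hq, hqA, h⟩ := regularAt_iff.1 hf A hA
        obtain ⟨P, hP⟩ := hp.comp hσ
        obtain ⟨Q, hQ⟩ := hq.comp hσ
        simp only at hP hQ
        have hQx : MvPolynomial.eval (c x) Q ≠ 0 := by rwa [← hQ, ← hAσ]
        refine ⟨(P, ⟨Q, hQx⟩), Subtype.ext (Filter.Germ.coe_eq.2 ?_)⟩
        filter_upwards [hleft, (RegularAt.eval hc Q).eventually_ne_zero hQx] with y hy hQy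
        obtain ⟨B, hB, hBσ⟩ := hy
        have hqB : q B.coords ≠ 0 := by rwa [hBσ, hQ]
        change f y * MvPolynomial.eval (c y) Q = MvPolynomial.eval (c y) P
        rw [h B y hB hqB, ← hP, ← hQ, ← hBσ, div_mul_cancel₀ _ hqB]
      exists_of_eq := by
        intro P Q hPQ
        have hev : ∀ᶠ y in 𝓝 x, MvPolynomial.eval (c y) P = MvPolynomial.eval (c y) Q :=
          Filter.Germ.coe_eq.1 (congrArg Subtype.val hPQ)
        obtain ⟨f, hf, hfA, hfN⟩ := exists_isPoly_of_mem_nhds hev A hA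
        obtain ⟨D', hD'⟩ := hD
        obtain ⟨F, hF⟩ := hf.comp hσ
        simp only at hF
        -- Equality of germs holds only on an open set of the chart. Multiplying by polynomials that
        -- vanish off this set gives an identity everywhere, and the ring is a domain.
        have hzero : D' * F * (P - Q) = 0 := MvPolynomial.funext fun t => by
          by_cases hDt : D t = 0
          · simp [← hD', hDt]
          by_cases hFt : f (σ t) = 0
          · simp [← hF, hFt]
          obtain ⟨y, B, hB, hBσ, rfl⟩ := hright t hDt
          have := hfN B y hB (by rwa [hBσ])
          simp only [Set.mem_ofPred_eq] at this
          simp [this]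
        have hD0 : D' ≠ 0 := fun h => hDx (by rw [hD', h, map_zero])
        have hF0 : F ≠ 0 := fun h => hfA (by rw [hAσ, hF, h, map_zero])
        have := (mul_eq_zero.1 hzero).resolve_left (mul_ne_zero hD0 hF0)
        exact ⟨1, by rw [sub_eq_zero.1 this]⟩ }
  exact IsRegularLocalRing.of_ringEquiv
    (IsLocalization.algEquiv m.primeCompl (Localization.AtPrime m) (localRing X x)).toRingEquiv

/-! ## Linear algebra -/

section LinearAlgebra

variable {E : Type} [AddCommGroup E] [Module ℂ E]

theorem finrank_span_image_Iio_le (v : ℕ → E) (e p : ℕ) :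
    Module.finrank ℂ (Submodule.span ℂ (v '' {q | e ≤ q ∧ q < p})) ≤ p - e := by
  classical
  have h : v '' {q | e ≤ q ∧ q < p} = ((Finset.Ico e p).image v : Finset E) := by
    ext y
    simp
  rw [h]
  exact (finrank_span_finset_le_card _).trans (Finset.card_image_le.trans (by simp))

/-- Vectors `v p ∈ A p` in general position with respect to the subspaces `B p`. -/
theorem exists_seq_notMem [FiniteDimensional ℂ E] (A B : ℕ → Submodule ℂ E) (e : ℕ → ℕ) (K : ℕ)
    (hAB : ∀ p < K, ∀ q < e p, q < p → A q ≤ B p)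
    (hdim : ∀ p < K, Module.finrank ℂ (B p) + (p - e p) < Module.finrank ℂ (A p)) :
    ∃ v : ℕ → E, ∀ p < K, v p ∈ A p ∧ v p ∉ B p ⊔ Submodule.span ℂ (v '' {q | q < p}) := by
  induction K with
  | zero => exact ⟨fun _ => 0, fun p hp => absurd hp (by omega)⟩
  | succ K ih =>
    obtain ⟨v, hv⟩ := ih (fun p hp => hAB p (by omega)) fun p hp => hdim p (by omega)
    -- The vectors with index below `e K` already lie in `B K`, so at most `K - e K` of the previous
    -- ones count.
    have hle : B K ⊔ Submodule.span ℂ (v '' {q | q < K}) ≤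
        B K ⊔ Submodule.span ℂ (v '' {q | e K ≤ q ∧ q < K}) := by
      refine sup_le le_sup_left (Submodule.span_le.2 ?_)
      rintro _ ⟨q, hq, rfl⟩
      by_cases hqe : q < e K
      · exact Submodule.mem_sup_left (hAB K (by omega) q hqe hq (hv q hq).1)
      · exact Submodule.mem_sup_right (Submodule.subset_span ⟨q, ⟨by omega, hq⟩, rfl⟩)
    have hlt : Module.finrank ℂ ↥(B K ⊔ Submodule.span ℂ (v '' {q | q < K})) <
        Module.finrank ℂ (A K) := by
      refine lt_of_le_of_lt (Submodule.finrank_mono hle) ?_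
      refine lt_of_le_of_lt (Submodule.finrank_add_le_finrank_add_finrank _ _) ?_
      have := finrank_span_image_Iio_le v (e K) K
      have := hdim K (by omega)
      omega
    obtain ⟨x, hxA, hxB⟩ := SetLike.not_le_iff_exists.1 fun h : A K ≤ _ =>
      (Submodule.finrank_mono h).not_gt hlt
    have himage : ∀ p ≤ K, Function.update v K x '' {q | q < p} = v '' {q | q < p} :=
      fun p hp => Set.image_congr fun q hq =>
        Function.update_of_ne (by have : q < p := hq; omega) _ _
    refine ⟨Function.update v K x, fun p hp => ?_⟩
    rw [himage p (by omega)]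
    by_cases hpK : p = K
    · subst hpK
      rw [Function.update_self]
      exact ⟨hxA, hxB⟩
    · rw [Function.update_of_ne hpK]
      exact hv p (by omega)

theorem linearIndependent_of_notMem_span {v : ℕ → E} {K : ℕ}
    (h : ∀ p < K, v p ∉ Submodule.span ℂ (v '' {q | q < p})) :
    LinearIndependent ℂ fun p : Fin K => v p := by
  have h1 : ∀ p ≤ K, LinearIndepOn ℂ v {q | q < p} := by
    intro p
    induction p with
    | zero => simp
    | succ p ih =>
      intro hp
      have h2 : {q | q < p + 1} = insert p {q | q < p} := by
        ext q
        simp only [Set.mem_ofPred_eq, Set.mem_insert_iff]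
        omega
      rw [h2, linearIndepOn_insert (by simp)]
      exact ⟨ih (by omega), h p (by omega)⟩
  exact (h1 K le_rfl).comp (fun p : Fin K => (⟨p, p.2⟩ : {q | q < K})) fun p q hpq =>
    Fin.ext (congrArg (fun x : {q | q < K} => x.1) hpq)

end LinearAlgebra

theorem exists_relative_compl {E : Type} [AddCommGroup E] [Module ℂ E] {N F : Submodule ℂ E}
    (h : N ≤ F) : ∃ U ≤ F, Disjoint N U ∧ N ⊔ U = F := by
  obtain ⟨U, hU⟩ := N.exists_isCompl
  refine ⟨U ⊓ F, inf_le_right, hU.disjoint.mono_right inf_le_left, ?_⟩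
  rw [← sup_inf_assoc_of_le _ h, hU.sup_eq_top, top_inf_eq]

theorem exists_matrix_span_eq {l : ℕ} (U : Submodule ℂ (Fin l → ℂ)) :
    ∃ (r : ℕ) (c : Matrix (Fin r) (Fin l) ℂ), Module.finrank ℂ U = r ∧
      LinearIndependent ℂ c.row ∧ Submodule.span ℂ (Set.range c.row) = U := by
  obtain ⟨A, hA⟩ := Frame.toGr_surjective
    (fun _ => ⟨U, rfl⟩ : MultiGr (fun _ : Unit => Module.finrank ℂ U) fun _ => l)
  exact ⟨_, A.mat (), rfl, A.linearIndependent_mat (), congrArg Subtype.val (congrFun hA ())⟩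

/-- Dual coordinates for a linearly independent family `b` in `F` and a complementary family. -/
theorem exists_adapted_coordinates {l r : ℕ} (F : Submodule ℂ (Fin l → ℂ))
    {b : Matrix (Fin r) (Fin l) ℂ} (hb : LinearIndependent ℂ b.row) (hbF : ∀ p, b.row p ∈ F) :
    ∃ (m : ℕ) (cv : Matrix (Fin m) (Fin l) ℂ)
      (R : Matrix (Fin l) (Fin r) ℂ) (G : Matrix (Fin l) (Fin m) ℂ), (∀ q, cv.row q ∈ F) ∧
      (∀ u ∈ F, u = Matrix.vecMul (Matrix.vecMul u R) b + Matrix.vecMul (Matrix.vecMul u G) cv) ∧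
      b * R = 1 ∧ b * G = 0 ∧ cv * R = 0 ∧ cv * G = 1 := by
  have hN : Submodule.span ℂ (Set.range b.row) ≤ F := Submodule.span_le.2 (by
    rintro _ ⟨p, rfl⟩
    exact hbF p)
  obtain ⟨U, hUF, hdisj, hsup⟩ := exists_relative_compl hN
  obtain ⟨m, cv, -, hcv, hcvU⟩ := exists_matrix_span_eq U
  rw [← hcvU] at hdisj
  have hM : LinearIndependent ℂ (Matrix.fromRows b cv).row :=
    LinearIndependent.sum_type hb hcv hdisj
  have hspan : Submodule.span ℂ (Set.range (Matrix.fromRows b cv).row) = F := by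
    have h : Set.range (Matrix.fromRows b cv).row = Set.range b.row ∪ Set.range cv.row :=
      Set.Sum.elim_range _ _
    rw [h, Submodule.span_union, hcvU, hsup]
  -- The two column blocks of a right inverse of the stacked basis are the dual coordinates.
  obtain ⟨L, hL⟩ := exists_mul_eq_one_of_linearIndependent hM
  obtain ⟨R, G, rfl⟩ : ∃ R G, L = Matrix.fromCols R G :=
    ⟨L.toCols₁, L.toCols₂, (Matrix.fromCols_toCols L).symm⟩
  have hL' := hL
  rw [Matrix.fromRows_mul_fromCols, ← Matrix.fromBlocks_one, Matrix.fromBlocks_inj] at hL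
  refine ⟨_, cv, R, G, fun q => hUF (hcvU.le (Submodule.subset_span ⟨q, rfl⟩)), fun u hu => ?_,
    hL.1, hL.2.1, hL.2.2.1, hL.2.2.2⟩
  rw [← hspan] at hu
  obtain ⟨x, hx⟩ := (Submodule.mem_span_range_iff_exists_fun ℂ).1 hu
  have hx' : Matrix.vecMul x (Matrix.fromRows b cv) = u := by
    rw [Matrix.vecMul_eq_sum, ← hx]
    rfl
  have h1 : Matrix.vecMul u (Matrix.fromCols R G) = x := by
    rw [← hx', Matrix.vecMul_vecMul, hL', Matrix.vecMul_one]
  have h2 : Matrix.vecMul (Matrix.vecMul u (Matrix.fromCols R G)) (Matrix.fromRows b cv) = u := by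
    rw [h1, hx']
  rw [Matrix.vecMul_fromCols, Matrix.vecMul_fromRows] at h2
  exact h2.symm

/-! ## Rank conditions -/

/-- A complement of `V ∩ F` in `V` is independent of `F`. The same combinations of a nearby frame
remain independent of `F`, and this bounds the dimension of the nearby intersection. -/
theorem isOpen_finrank_inf_le (a : ι) (F : Submodule ℂ (Fin (n a) → ℂ)) (i : ℕ) :
    IsOpen {V : MultiGr k n |
      Module.finrank ℂ ((V a).1 ⊓ F : Submodule ℂ (Fin (n a) → ℂ)) ≤ i} := by
  refine isOpen_iff.2 fun A hA => ?_
  obtain ⟨U, hUV, hdisj, hsup⟩ :=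
    exists_relative_compl (inf_le_left : (A.toGr a).1 ⊓ F ≤ (A.toGr a).1)
  obtain ⟨r, u, hr, hu, huU⟩ := exists_matrix_span_eq U
  obtain ⟨s, f, -, hf, hfF⟩ := exists_matrix_span_eq F
  obtain ⟨g, hg⟩ := exists_matrix_mul_eq (A := A.mat a) (B := u) fun p =>
    hUV (huU.le (Submodule.subset_span ⟨p, rfl⟩))
  let w : (Coord k n → ℂ) → Matrix (Fin r ⊕ Fin s) (Fin (n a)) ℂ :=
    fun v => Matrix.fromRows (g * matOf v a) f
  have hw : ∀ p q, IsPoly fun v => w v p q := by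
    rintro (p | p) q
    · exact IsPoly.matrix_mul (M := fun _ => g) (fun _ _ => IsPoly.const _) (isPoly_matOf a) p q
    · exact IsPoly.const _
  have hwA : LinearIndependent ℂ (w A.coords).row := by
    have hUF : Disjoint U F := by
      rw [disjoint_iff_inf_le] at hdisj ⊢
      exact fun x hx => hdisj ⟨⟨hUV hx.1, hx.2⟩, hx.1⟩
    rw [← huU, ← hfF, hg] at hUF
    exact LinearIndependent.sum_type (hg ▸ hu) hf hUF
  obtain ⟨h, hh, hhA, hhw⟩ := exists_isPoly_linearIndependent hw hwA
  refine ⟨h, hh, hhA, fun B hB => ?_⟩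
  obtain ⟨h1, -, h3⟩ := linearIndependent_sum.1 (hhw _ hB)
  have hspan : Submodule.span ℂ (Set.range (g * B.mat a).row) ≤ (B.toGr a).1 :=
    Submodule.span_le.2 (by
      rintro _ ⟨p, rfl⟩
      exact matrix_mul_mem_span g _ p)
  have h4 := Submodule.finrank_sup_add_finrank_inf_eq ((B.toGr a).1 ⊓ F)
    (Submodule.span ℂ (Set.range (g * B.mat a).row))
  have h5 : (B.toGr a).1 ⊓ F ⊓ Submodule.span ℂ (Set.range (g * B.mat a).row) = ⊥ := by
    rw [eq_bot_iff, ← disjoint_iff_inf_le]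
    exact (h3.mono_right (inf_le_right.trans hfF.ge)).symm
  have h6 : Module.finrank ℂ (Submodule.span ℂ (Set.range (g * B.mat a).row)) =
      r := by
    simpa using finrank_span_eq_card (R := ℂ) (b := (g * B.mat a).row) h1
  have h7 := Submodule.finrank_mono (sup_le inf_le_left hspan :
    (B.toGr a).1 ⊓ F ⊔ Submodule.span ℂ (Set.range (g * B.mat a).row) ≤ (B.toGr a).1)
  have h8 := Submodule.finrank_sup_add_finrank_inf_eq ((A.toGr a).1 ⊓ F) U
  rw [hsup, hdisj.eq_bot, finrank_bot, hr, (A.toGr a).2] at h8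
  rw [h5, finrank_bot, h6] at h4
  rw [(B.toGr a).2] at h7
  simp only [Set.mem_ofPred_eq] at hA ⊢
  omega

theorem isClosed_le_finrank_inf (a : ι) (F : Submodule ℂ (Fin (n a) → ℂ)) (i : ℕ) :
    IsClosed {V : MultiGr k n |
      i ≤ Module.finrank ℂ ((V a).1 ⊓ F : Submodule ℂ (Fin (n a) → ℂ))} := by
  cases i with
  | zero => simp
  | succ i =>
    refine ⟨?_⟩
    convert isOpen_finrank_inf_le a F i using 1
    ext V
    simp

theorem isClosed_le_space (a : ι) (F : Submodule ℂ (Fin (n a) → ℂ)) :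
    IsClosed {V : MultiGr k n | (V a).1 ≤ F} := by
  convert isClosed_le_finrank_inf a F (k a) using 1
  ext V
  simp only [Set.mem_ofPred_eq]
  constructor
  · intro h
    rw [inf_eq_left.2 h, (V a).2]
  · intro h
    exact inf_eq_left.1 (Submodule.eq_of_le_of_finrank_le inf_le_left (by rwa [(V a).2]))

/-- If the inclusion fails, some frame vector of the first space is independent of a frame of the
second, an open condition. -/
theorem isClosed_le_le {k : ι → ℕ} {l : ℕ} (a b : ι) :
    IsClosed {V : MultiGr k (fun _ => l) | (V a).1 ≤ (V b).1} := by
  refine ⟨isOpen_iff.2 fun A hA => ?_⟩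
  obtain ⟨p, hp⟩ : ∃ p, (A.mat a).row p ∉ (A.toGr b).1 := by
    by_contra! h
    refine hA (Submodule.span_le.2 ?_)
    rintro _ ⟨p, rfl⟩
    exact h p
  let w : (Coord k (fun _ => l) → ℂ) → Matrix (Option (Fin (k b))) (Fin l) ℂ :=
    fun v => Matrix.of fun o => o.elim ((matOf v a).row p) (matOf v b).row
  have hw : ∀ o q, IsPoly fun v => w v o q := by
    rintro (_ | o) q
    · exact isPoly_matOf (n := fun _ => l) a p q
    · exact isPoly_matOf (n := fun _ => l) b o q
  obtain ⟨h, hh, hhA, hhw⟩ := exists_isPoly_linearIndependent hw (v₀ := A.coords)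
    (linearIndependent_option.2 ⟨A.linearIndependent_mat b, hp⟩)
  refine ⟨h, hh, hhA, fun B hB hle => ?_⟩
  exact (linearIndependent_option.1 (hhw _ hB)).2 (hle (Submodule.subset_span ⟨p, rfl⟩))

/-! ## Varieties of chains of subspaces -/

/-- Prescribed dimensions and ambient spaces for the members of a chain of subspaces of `ℂ^l`.
The members of the chain are ordered by `pos`, the largest dimension is `top`, and `step p` is the
first member of dimension greater than `p`. -/
structure ChainData (ι : Type) (l : ℕ) where
  dim : ι → ℕ
  pos : ι → ℕ
  space : ι → Submodule ℂ (Fin l → ℂ)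
  top : ℕ
  step : ℕ → ι
  dim_mono : ∀ a b, pos a ≤ pos b → dim a ≤ dim b
  space_mono : ∀ a b, pos a ≤ pos b → space a ≤ space b
  dim_le_top : ∀ a, dim a ≤ top
  lt_dim_step : ∀ p < top, p < dim (step p)
  step_le : ∀ p < top, ∀ a, p < dim a → pos (step p) ≤ pos a

namespace ChainData

variable {l : ℕ} (c : ChainData ι l)

/-- The variety of chains with the prescribed dimensions in the prescribed spaces. -/
def variety : Set (MultiGr c.dim fun _ => l) :=
  {Z | (∀ a, (Z a).1 ≤ c.space a) ∧ ∀ a b, c.pos a ≤ c.pos b → (Z a).1 ≤ (Z b).1}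

theorem isClosed_variety : IsClosed c.variety := by
  have h : c.variety = (⋂ a, {Z | (Z a).1 ≤ c.space a}) ∩
      ⋂ a, ⋂ b, ⋂ _ : c.pos a ≤ c.pos b, {Z | (Z a).1 ≤ (Z b).1} := by
    ext Z
    simp only [variety, Set.mem_ofPred_eq, Set.mem_inter_iff, Set.mem_iInter]
  rw [h]
  exact (isClosed_iInter fun a => isClosed_le_space a _).inter
    (isClosed_iInter fun a => isClosed_iInter fun b => isClosed_iInter fun _ => isClosed_le_le a b)

/-- The first `dim a` vectors of a `top`-tuple of vectors. -/
def rows (v : Matrix (Fin c.top) (Fin l) ℂ) (a : ι) : Matrix (Fin (c.dim a)) (Fin l) ℂ :=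
  v.submatrix (Fin.castLE (c.dim_le_top a)) id

/-- If `p < dim a`, then `step p` comes no later than `a`. Thus one condition per vector controls
all members of the chain. -/
theorem row_mem_space {v : Matrix (Fin c.top) (Fin l) ℂ}
    {W : ι → Submodule ℂ (Fin l → ℂ)} (hW : ∀ a b, c.pos a ≤ c.pos b → W a ≤ W b)
    (hv : ∀ p : Fin c.top, v.row p ∈ W (c.step p)) (a : ι) (p : Fin (c.dim a)) :
    (c.rows v a).row p ∈ W a :=
  hW _ _ (c.step_le p (p.2.trans_le (c.dim_le_top a)) a p.2)
    (hv (Fin.castLE (c.dim_le_top a) p))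

theorem linearIndependent_rows {v : Matrix (Fin c.top) (Fin l) ℂ}
    (hv : LinearIndependent ℂ v.row) (a : ι) : LinearIndependent ℂ (c.rows v a).row :=
  hv.comp _ (Fin.castLE_injective _)

theorem toGr_rows_mem_variety {v : Matrix (Fin c.top) (Fin l) ℂ}
    (hv : ∀ a, LinearIndependent ℂ (c.rows v a).row) (hvF : ∀ p : Fin c.top, v.row p ∈ c.space (c.step p)) :
    (Frame.ofMat (n := fun _ => l) (c.rows v) hv).toGr ∈ c.variety := by
  refine ⟨fun a => Submodule.span_le.2 ?_, fun a b hab => Submodule.span_le.2 ?_⟩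
  · rintro _ ⟨p, rfl⟩
    exact c.row_mem_space c.space_mono hvF a p
  · rintro _ ⟨p, rfl⟩
    exact Submodule.subset_span ⟨Fin.castLE (c.dim_mono a b hab) p, rfl⟩

theorem toGr_rows_eq {v : Matrix (Fin c.top) (Fin l) ℂ}
    (hv : ∀ a, LinearIndependent ℂ (c.rows v a).row) {Z : MultiGr c.dim fun _ => l}
    (hZ : Z ∈ c.variety) (hvZ : ∀ p : Fin c.top, v.row p ∈ (Z (c.step p)).1) :
    (Frame.ofMat (n := fun _ => l) (c.rows v) hv).toGr = Z := by
  funext a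
  refine Subtype.ext (Submodule.eq_of_le_of_finrank_eq (Submodule.span_le.2 ?_) ?_)
  · rintro _ ⟨p, rfl⟩
    exact c.row_mem_space (W := fun a => (Z a).1) hZ.2 hvZ a p
  · rw [(Z a).2]
    exact ((Frame.ofMat (n := fun _ => l) (c.rows v) hv).toGr a).2

/-- Greedy choice: the space for the `p`-th vector has dimension greater than `p`, so the `p`
vectors already chosen cannot span it. -/
theorem exists_rows_of_finrank (W : ι → Submodule ℂ (Fin l → ℂ))
    (hW : ∀ a, c.dim a ≤ Module.finrank ℂ (W a)) :
    ∃ v : Matrix (Fin c.top) (Fin l) ℂ, LinearIndependent ℂ v.row ∧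
      ∀ p : Fin c.top, v.row p ∈ W (c.step p) := by
  obtain ⟨v, hv⟩ := exists_seq_notMem (fun p => W (c.step p)) (fun _ => ⊥) (fun _ => 0) c.top
    (fun p _ q hq => absurd hq (by omega))
    fun p hp => by simpa using (c.lt_dim_step p hp).trans_le (hW _)
  refine ⟨Matrix.of fun p => v p, linearIndependent_of_notMem_span fun p hp => ?_,
    fun p => (hv p p.2).1⟩
  simpa using (hv p hp).2

theorem exists_rows {Z : MultiGr c.dim fun _ => l} (hZ : Z ∈ c.variety) :
    ∃ (v : Matrix (Fin c.top) (Fin l) ℂ) (hv : LinearIndependent ℂ v.row),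
      (∀ p : Fin c.top, v.row p ∈ (Z (c.step p)).1) ∧
      (Frame.ofMat (n := fun _ => l) (c.rows v) (c.linearIndependent_rows hv)).toGr = Z := by
  obtain ⟨v, hv, hvZ⟩ := c.exists_rows_of_finrank (fun a => (Z a).1) fun a => (Z a).2.ge
  exact ⟨v, hv, hvZ, c.toGr_rows_eq _ hZ hvZ⟩

end ChainData

/-! ### Irreducibility -/

theorem IsPoly.exists_mul_ne_zero {σ : Type} {f g : (σ → ℂ) → ℂ} (hf : IsPoly f) (hg : IsPoly g)
    {s t : σ → ℂ} (hs : f s ≠ 0) (ht : g t ≠ 0) : ∃ u, f u * g u ≠ 0 := by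
  obtain ⟨P, hP⟩ := hf
  obtain ⟨Q, hQ⟩ := hg
  by_contra! h
  have h1 : P * Q = 0 := MvPolynomial.funext fun u => by rw [map_mul, ← hP, ← hQ, h, map_zero]
  rcases mul_eq_zero.1 h1 with h0 | h0
  · exact hs (by rw [hP, h0, map_zero])
  · exact ht (by rw [hQ, h0, map_zero])

/-- A variety that is parametrized by an open subset of an affine space is irreducible. -/
theorem irreducibleSpace_of_parametrization {X : Set (MultiGr k n)} (hX : X.Nonempty) {σ : Type}
    (R : (σ → ℂ) → Coord k n → ℂ) (hR : ∀ s, IsPoly fun t => R t s)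
    (hsurj : ∀ x ∈ X, ∃ (A : Frame k n) (t : σ → ℂ) (D : (σ → ℂ) → ℂ), A.toGr = x ∧
      A.coords = R t ∧ IsPoly D ∧ D t ≠ 0 ∧
        ∀ u, D u ≠ 0 → ∃ B : Frame k n, B.toGr ∈ X ∧ B.coords = R u) : IrreducibleSpace X := by
  have : Nonempty X := hX.to_subtype
  refine @IrreducibleSpace.mk _ _ ⟨?_⟩ this
  rintro U V hU hV ⟨x, -, hxU⟩ ⟨y, -, hyV⟩
  obtain ⟨A, t, D, hA, hAt, hD, hDt, hDX⟩ := hsurj x x.2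
  obtain ⟨A', t', -, hA', hAt', -⟩ := hsurj y y.2
  obtain ⟨f, hf, hfA, hfU⟩ := exists_isPoly_of_mem_nhds (hU.mem_nhds hxU) A hA
  obtain ⟨g, hg, hgA, hgV⟩ := exists_isPoly_of_mem_nhds (hV.mem_nhds hyV) A' hA'
  obtain ⟨u, hu⟩ := (hD.mul (hf.comp hR)).exists_mul_ne_zero (hg.comp hR)
    (mul_ne_zero hDt (hAt ▸ hfA)) (hAt' ▸ hgA)
  obtain ⟨B, hBX, hBu⟩ := hDX u (left_ne_zero_of_mul (left_ne_zero_of_mul hu))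
  refine ⟨⟨B.toGr, hBX⟩, trivial, hfU B _ rfl ?_, hgV B _ rfl ?_⟩
  · rw [hBu]
    exact right_ne_zero_of_mul (left_ne_zero_of_mul hu)
  · rw [hBu]
    exact right_ne_zero_of_mul hu

namespace ChainData

variable {l : ℕ} (c : ChainData ι l)

/-- The parameters are the coordinates of the `p`-th vector in a basis of `space (step p)`;
independence of the tuple is the open condition. -/
theorem irreducibleSpace_variety (h : c.variety.Nonempty) : IrreducibleSpace c.variety := by
  let β := fun a => Module.finBasis ℂ (c.space a)
  let w : ((Σ p : Fin c.top, Fin (Module.finrank ℂ (c.space (c.step p)))) → ℂ) →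
      Matrix (Fin c.top) (Fin l) ℂ := fun t => Matrix.of fun p j =>
    ∑ q, t ⟨p, q⟩ * (β (c.step p) q : Fin l → ℂ) j
  have hw : ∀ p j, IsPoly fun t => w t p j := fun p j => by
    change IsPoly fun t : (Σ p : Fin c.top, Fin (Module.finrank ℂ (c.space (c.step p)))) → ℂ =>
      ∑ q, t ⟨p, q⟩ * (β (c.step p) q : Fin l → ℂ) j
    exact IsPoly.sum _ fun q _ => (IsPoly.coord _).mul (IsPoly.const _)
  have hw' : ∀ t (p : Fin c.top), (w t).row p =
      ((∑ q, t ⟨p, q⟩ • β (c.step p) q : c.space (c.step p)) : Fin l → ℂ) := fun t p => by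
    ext j
    simp [w]
  refine irreducibleSpace_of_parametrization h
    (fun t s => c.rows (w t) s.1 s.2.1 s.2.2) (fun s => hw _ _) fun Z hZ => ?_
  obtain ⟨v, hv, hvZ, rfl⟩ := c.exists_rows hZ
  have hvF : ∀ p : Fin c.top, v.row p ∈ c.space (c.step p) := fun p => hZ.1 _ (hvZ p)
  let t : (Σ p : Fin c.top, Fin (Module.finrank ℂ (c.space (c.step p)))) → ℂ :=
    fun s => (β (c.step s.1)).repr ⟨v.row s.1, hvF s.1⟩ s.2
  have ht : w t = v := by
    ext p j
    refine congrFun ((hw' t p).trans ?_) j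
    rw [(β (c.step p)).sum_repr ⟨v.row p, hvF p⟩]
    rfl
  obtain ⟨D, hD, hDt, hDw⟩ := exists_isPoly_linearIndependent (v₀ := t) hw (ht ▸ hv)
  refine ⟨_, t, D, rfl, ?_, hD, hDt, fun u hu => ⟨_, c.toGr_rows_mem_variety
    (c.linearIndependent_rows (hDw u hu)) fun p => ?_, rfl⟩⟩
  · funext s
    rw [ht]
    rfl
  · rw [hw']
    exact SetLike.coe_mem _

end ChainData

/-! ### Smoothness -/

/-- The basis of the row space of `B` which is dual to the functionals given by the columns
of `R`. -/
def normalize {l r : ℕ} (R : Matrix (Fin l) (Fin r) ℂ) (B : Matrix (Fin r) (Fin l) ℂ) :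
    Matrix (Fin r) (Fin l) ℂ :=
  (B * R)⁻¹ * B

/-- Invariance under change of basis makes the entries of the normalized matrix functions on the
Grassmannian. -/
theorem normalize_mul {l r : ℕ} (R : Matrix (Fin l) (Fin r) ℂ) (B : Matrix (Fin r) (Fin l) ℂ)
    {g : Matrix (Fin r) (Fin r) ℂ} (hg : g.det ≠ 0) : normalize R (g * B) = normalize R B := by
  rw [normalize, normalize, Matrix.mul_assoc, Matrix.mul_inv_rev, Matrix.mul_assoc,
    Matrix.nonsing_inv_mul_cancel_left _ _ (isUnit_iff_ne_zero.2 hg)]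

theorem normalize_mul_right {l r : ℕ} (R : Matrix (Fin l) (Fin r) ℂ)
    {B : Matrix (Fin r) (Fin l) ℂ} (h : (B * R).det ≠ 0) : normalize R B * R = 1 := by
  rw [normalize, Matrix.mul_assoc, Matrix.nonsing_inv_mul _ (isUnit_iff_ne_zero.2 h)]

theorem normalize_row_eq {l r : ℕ} {R : Matrix (Fin l) (Fin r) ℂ}
    {B : Matrix (Fin r) (Fin l) ℂ} (h : (B * R).det ≠ 0) {p : Fin r}
    (hp : (B * R).row p = Pi.single p 1) : (normalize R B).row p = B.row p := by
  have h1 : ((B * R)⁻¹).row p = Pi.single p 1 := by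
    have h2 : Matrix.vecMul (Pi.single p 1) ((B * R) * (B * R)⁻¹) = Pi.single p 1 := by
      rw [Matrix.mul_nonsing_inv _ (isUnit_iff_ne_zero.2 h), Matrix.vecMul_one]
    rwa [← Matrix.vecMul_vecMul, Matrix.single_one_vecMul, hp, Matrix.single_one_vecMul] at h2
  rw [← Matrix.single_one_vecMul, normalize, ← Matrix.vecMul_vecMul, Matrix.single_one_vecMul, h1,
    Matrix.single_one_vecMul]

theorem normalize_mul_apply {l r m : ℕ} (R : Matrix (Fin l) (Fin r) ℂ)
    (B : Matrix (Fin r) (Fin l) ℂ) (G : Matrix (Fin l) (Fin m) ℂ) (p : Fin r) (q : Fin m) :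
    (normalize R B * G) p q = ((B * R).adjugate * B * G) p q / (B * R).det := by
  rw [normalize, Matrix.inv_def, Matrix.smul_mul, Matrix.smul_mul, Matrix.smul_apply,
    Ring.inverse_eq_inv, smul_eq_mul, inv_mul_eq_div]

theorem isPoly_det_mul {σ : Type} {l r : ℕ} {M : (σ → ℂ) → Matrix (Fin r) (Fin l) ℂ}
    (hM : ∀ p q, IsPoly fun v => M v p q) (R : Matrix (Fin l) (Fin r) ℂ) :
    IsPoly fun v => (M v * R).det :=
  IsPoly.det (IsPoly.matrix_mul hM fun _ _ => IsPoly.const _)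

theorem isPoly_adjugate_mul {σ : Type} {l r m : ℕ} {M : (σ → ℂ) → Matrix (Fin r) (Fin l) ℂ}
    (hM : ∀ p q, IsPoly fun v => M v p q) (R : Matrix (Fin l) (Fin r) ℂ)
    (G : Matrix (Fin l) (Fin m) ℂ) (p : Fin r) (q : Fin m) :
    IsPoly fun v => ((M v * R).adjugate * M v * G) p q := by
  have h1 : ∀ p q, IsPoly fun v => (M v * R) p q :=
    IsPoly.matrix_mul hM fun _ _ => IsPoly.const _
  have h2 : ∀ p q, IsPoly fun v => ((M v * R).adjugate * M v) p q :=
    IsPoly.matrix_mul (IsPoly.adjugate h1) hM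
  exact IsPoly.matrix_mul (N := fun _ => G) h2 (fun _ _ => IsPoly.const _) p q

namespace ChainData

variable {l : ℕ} (c : ChainData ι l)

/-- The chart at `x` sends a nearby chain to its unique tuple whose `p`-th vector is `b p` plus a
combination of the complementary vectors `cv (step p)`. These coefficients are free parameters. -/
theorem isSmooth_variety [Finite ι] : IsSmooth c.variety := by
  classical
  have := Fintype.ofFinite ι
  intro x
  obtain ⟨b, hb, hbx, hbX⟩ := c.exists_rows x.2
  choose m cv R G hcv hF hbR hbG hcR hcG using fun a =>
    exists_adapted_coordinates (c.space a) (c.linearIndependent_rows hb a)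
      (c.row_mem_space c.space_mono (fun p => x.2.1 _ (hbx p)) a)
  let w : ((Σ p : Fin c.top, Fin (m (c.step p))) → ℂ) → Matrix (Fin c.top) (Fin l) ℂ :=
    fun t => Matrix.of fun p => b.row p + Matrix.vecMul (fun q => t ⟨p, q⟩) (cv (c.step p))
  have hw : ∀ p j, IsPoly fun t => w t p j := fun p j => by
    change IsPoly fun t : (Σ p : Fin c.top, Fin (m (c.step p))) → ℂ =>
      b p j + ∑ q, t ⟨p, q⟩ * cv (c.step p) q j
    exact (IsPoly.const (b p j)).add
      (IsPoly.sum _ fun q _ => (IsPoly.coord _).mul (IsPoly.const _))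
  let ix : ∀ p : Fin c.top, Fin (c.dim (c.step p)) := fun p => ⟨p, c.lt_dim_step p p.2⟩
  have hrows : ∀ (v : Matrix (Fin c.top) (Fin l) ℂ) (p : Fin c.top),
      (c.rows v (c.step p)).row (ix p) = v.row p := fun v p => rfl
  let B : c.variety → Frame c.dim fun _ => l := fun y => (Frame.toGr_surjective y.1).choose
  have hB : ∀ y, (B y).toGr = y.1 := fun y => (Frame.toGr_surjective y.1).choose_spec
  have hnorm : ∀ (A : Frame c.dim fun _ => l) (y : c.variety), A.toGr = y.1 → ∀ a,
      normalize (R a) (A.mat a) = normalize (R a) ((B y).mat a) := fun A y hA a => by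
    obtain ⟨g, hg, hgA⟩ := Frame.exists_of_toGr_eq ((hB y).trans hA.symm)
    rw [hgA, normalize_mul _ _ (hg a)]
  -- Row `p` of the normalized basis of the member `step p`, read in the complementary directions.
  -- By `hnorm` the choice of frame is immaterial.
  let coord : c.variety → (Σ p : Fin c.top, Fin (m (c.step p))) → ℂ := fun y s =>
    (normalize (R (c.step s.1)) ((B y).mat (c.step s.1)) * G (c.step s.1)) (ix s.1) s.2
  have hdet : ∀ A : Frame c.dim fun _ => l, A.toGr = x.1 → ∀ a, (A.mat a * R a).det ≠ 0 := by
    intro A hA a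
    obtain ⟨g, hg, hgA⟩ := Frame.exists_of_toGr_eq (hbX.trans hA.symm)
    rw [hgA, Frame.mat_ofMat, Matrix.mul_assoc, hbR, Matrix.mul_one]
    exact hg a
  have hdetPoly : ∀ a, IsPoly fun v : Coord c.dim (fun _ => l) → ℂ => (matOf v a * R a).det :=
    fun a => isPoly_det_mul (isPoly_matOf (n := fun _ => l) a) _
  have hcoord : ∀ s, RegularAt (fun y => coord y s) x := fun s => by
    refine regularAt_iff.2 fun A hA => ⟨fun v => ((matOf v (c.step s.1) * R _).adjugate *
      matOf v (c.step s.1) * G _) (ix s.1) s.2, _, ?_, hdetPoly (c.step s.1), hdet A hA _, ?_⟩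
    · exact isPoly_adjugate_mul (isPoly_matOf (n := fun _ => l) _) _ _ _ _
    · intro A' y hA' _
      simp only [coord]
      rw [← hnorm A' y hA', normalize_mul_apply]
  -- Row `q` varies along `cv (step q)`, which `R a` need not kill when `step q` differs from `a`;
  -- invertibility is therefore a genuine condition on `t`.
  let D : ((Σ p : Fin c.top, Fin (m (c.step p))) → ℂ) → ℂ :=
    fun t => ∏ a, (c.rows (w t) a * R a).det
  have hD : IsPoly D := IsPoly.prod _ fun a _ => isPoly_det_mul (fun p q => hw _ _) _
  have hcx : coord x = 0 := by
    funext s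
    simp only [coord]
    rw [← hnorm _ x hbX, Frame.mat_ofMat, normalize, hbR, inv_one, Matrix.one_mul, hbG]
    rfl
  have hw0 : w 0 = b := by
    ext p j
    have h0 : (fun q => (0 : (Σ p : Fin c.top, Fin (m (c.step p))) → ℂ) ⟨p, q⟩) = 0 := rfl
    simp only [w, h0, Matrix.zero_vecMul, add_zero, Matrix.of_apply, Matrix.row_apply]
  have hDx : D (coord x) ≠ 0 := by
    simp [D, hcx, hw0, hbR]
  refine isRegularLocalRing_of_chart x coord hcoord (fun t s => c.rows (w t) s.1 s.2.1 s.2.2)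
    (fun s => hw _ _) ?_ D hD hDx ?_
  · have h1 : ∀ᶠ y in 𝓝 x, ∀ a, ((B y).mat a * R a).det ≠ 0 := by
      refine mem_nhds_of_isPoly (B x) (hB x) (IsPoly.prod Finset.univ fun a _ => hdetPoly a)
        (Finset.prod_ne_zero_iff.2 fun a _ => hdet _ (hB x) a) fun A y hA hne a => ?_
      obtain ⟨g, hg, hgA⟩ := Frame.exists_of_toGr_eq (hA.trans (hB y).symm)
      rw [hgA, Matrix.mul_assoc, Matrix.det_mul]
      exact mul_ne_zero (hg a) (Finset.prod_ne_zero_iff.1 hne a (Finset.mem_univ a))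
    have h2 : ∀ᶠ y in 𝓝 x, D (coord y) ≠ 0 := by
      obtain ⟨P, hP⟩ := hD
      simp only [hP] at hDx ⊢
      exact (RegularAt.eval hcoord P).eventually_ne_zero hDx
    filter_upwards [h1, h2] with y hy hDy
    have hind : ∀ a, LinearIndependent ℂ (c.rows (w (coord y)) a).row := fun a =>
      linearIndependent_of_det_mul_ne_zero (Finset.prod_ne_zero_iff.1 hDy a (Finset.mem_univ a))
    refine ⟨_, c.toGr_rows_eq hind y.2 fun p => ?_, rfl⟩
    set u := (normalize (R (c.step p)) ((B y).mat (c.step p))).row (ix p) with hu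
    have huZ : u ∈ (y.1 (c.step p)).1 := by
      rw [← hB y]
      exact matrix_mul_mem_span _ _ _
    suffices (w (coord y)).row p = u by rwa [this]
    rw [hF _ u (y.2.1 _ huZ)]
    -- The normalized row has dual coordinates `e_p` along `b`, so in the adapted decomposition its
    -- `b`-part is exactly `b p`.
    have h3 : Matrix.vecMul u (R (c.step p)) = Pi.single (ix p) 1 := by
      rw [hu, ← Matrix.single_one_vecMul, Matrix.vecMul_vecMul, normalize_mul_right _ (hy _),
        Matrix.vecMul_one]
    rw [h3, Matrix.single_one_vecMul, hrows]
    rfl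
  · intro t ht
    have hdett : ∀ a, (c.rows (w t) a * R a).det ≠ 0 := fun a =>
      Finset.prod_ne_zero_iff.1 ht a (Finset.mem_univ a)
    have hind : ∀ a, LinearIndependent ℂ (c.rows (w t) a).row := fun a =>
      linearIndependent_of_det_mul_ne_zero (hdett a)
    have hwF : ∀ p : Fin c.top, (w t).row p ∈ c.space (c.step p) := fun p => by
      refine Submodule.add_mem _ (x.2.1 _ (hbx p)) ?_
      rw [Matrix.vecMul_eq_sum]
      exact Submodule.sum_mem _ fun q _ => Submodule.smul_mem _ _ (hcv _ q)
    refine ⟨⟨_, c.toGr_rows_mem_variety hind hwF⟩, _, rfl, rfl, ?_⟩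
    funext s
    obtain ⟨p, q⟩ := s
    have hrow : ∀ {r : ℕ} (N : Matrix (Fin l) (Fin r) ℂ), Matrix.vecMul ((w t).row p) N =
        Matrix.vecMul (b.row p) N + Matrix.vecMul (fun q => t ⟨p, q⟩) (cv (c.step p) * N) := by
      intro r N
      rw [← Matrix.vecMul_vecMul, ← Matrix.add_vecMul]
      rfl
    have hbrow : ∀ {r : ℕ} (N : Matrix (Fin l) (Fin r) ℂ), Matrix.vecMul (b.row p) N =
        (c.rows b (c.step p) * N).row (ix p) := fun N => rfl
    simp only [coord]
    rw [← hnorm _ _ rfl, Frame.mat_ofMat]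
    have h4 : (c.rows (w t) (c.step p) * R (c.step p)).row (ix p) = Pi.single (ix p) 1 := by
      have : (c.rows (w t) (c.step p) * R (c.step p)).row (ix p) =
        Matrix.vecMul ((w t).row p) (R (c.step p)) := rfl
      rw [this, hrow, hcR, Matrix.vecMul_zero, add_zero, hbrow, hbR]
      funext i
      simp [Matrix.one_apply, Pi.single_apply, eq_comm]
    have h5 : (normalize (R (c.step p)) (c.rows (w t) (c.step p)) * G (c.step p)).row (ix p) =
        Matrix.vecMul ((w t).row p) (G (c.step p)) := by
      have : (normalize (R (c.step p)) (c.rows (w t) (c.step p)) * G (c.step p)).row (ix p) =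
        Matrix.vecMul ((normalize (R (c.step p)) (c.rows (w t) (c.step p))).row (ix p))
          (G (c.step p)) := rfl
      rw [this, normalize_row_eq (hdett _) h4, hrows]
    refine (congrFun h5 q).trans ?_
    rw [hrow, hbrow, hbG, hcG, Matrix.vecMul_one]
    exact zero_add _

end ChainData

/-! ## Schubert varieties and their incidence varieties -/

theorem finrank_add_finrank_le_of_le {E : Type} [AddCommGroup E] [Module ℂ E]
    [FiniteDimensional ℂ E] {A B C : Submodule ℂ E} (hA : A ≤ C) (hB : B ≤ C) :
    Module.finrank ℂ A + Module.finrank ℂ B ≤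
      Module.finrank ℂ C + Module.finrank ℂ (A ⊓ B : Submodule ℂ E) := by
  rw [← Submodule.finrank_sup_add_finrank_inf_eq]
  exact Nat.add_le_add_right (Submodule.finrank_mono (sup_le hA hB)) _

section Schubert

variable {k l m : ℕ} {F : Fin m → Submodule ℂ (Fin l → ℂ)} {i : Fin m → ℕ}

namespace IsSchubertPair

theorem finrank_lt (h : IsSchubertPair k F i) {α β : Fin m} (hαβ : α < β) :
    Module.finrank ℂ (F α) < Module.finrank ℂ (F β) :=
  Submodule.finrank_lt_finrank_of_lt (h.flag hαβ)

/-- The conditions of the essential indices imply all the others. -/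
theorem le_finrank_inf (h : IsSchubertPair k F i) {V : Submodule ℂ (Fin l → ℂ)}
    (hV : Module.finrank ℂ V = k)
    (hess : ∀ α, IsEssential k F i α →
      i α ≤ Module.finrank ℂ (V ⊓ F α : Submodule ℂ (Fin l → ℂ))) (α : Fin m) :
    i α ≤ Module.finrank ℂ (V ⊓ F α : Submodule ℂ (Fin l → ℂ)) := by
  -- The condition of `β` implies that of `α`, because `F β ≤ F α` and the bounds agree.
  obtain ⟨β, hβ, hβmin⟩ := Set.exists_min_image {β | i β = i α} id (Set.toFinite _) ⟨α, rfl⟩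
  have hβα : β ≤ α := hβmin α rfl
  have hβlt : ∀ δ < β, i δ < i β := fun δ hδ => by
    refine lt_of_le_of_ne (h.mono hδ.le) fun he => ?_
    exact (hβmin δ (he.trans hβ)).not_gt hδ
  -- The condition of `γ` implies that of `β`, by the codimension of `F β` in `F γ`. The two
  -- extremal choices make `γ` essential, unless its bound is automatic from `dim V = k`.
  obtain ⟨γ, ⟨hβγ, hγ⟩, hγmax⟩ := Set.exists_max_image
    {γ | β ≤ γ ∧ i γ + Module.finrank ℂ (F β) = i β + Module.finrank ℂ (F γ)} id (Set.toFinite _)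
    ⟨β, le_rfl, rfl⟩
  have h3 : ∀ δ < γ, i δ < i γ := fun δ hδ => by
    rcases hβγ.eq_or_lt with rfl | hlt
    · exact hβlt δ hδ
    · have h1 := h.finrank_lt hlt
      rcases lt_or_ge δ β with hδβ | hδβ
      · have := hβlt δ hδβ
        omega
      · have h2 := h.slope β δ hδβ
        have h4 := h.finrank_lt hδ
        omega
  have h4 : ∀ δ, γ < δ → i δ + Module.finrank ℂ (F γ) < i γ + Module.finrank ℂ (F δ) :=
    fun δ hδ => by
      refine lt_of_le_of_ne (h.slope γ δ hδ.le) fun he => ?_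
      exact (hγmax δ ⟨hβγ.trans hδ.le, by omega⟩).not_gt hδ
  have hγV : i γ ≤ Module.finrank ℂ (V ⊓ F γ : Submodule ℂ (Fin l → ℂ)) := by
    by_cases h1 : 0 < i γ
    · by_cases h2 : k + Module.finrank ℂ (F γ) < l + i γ
      · exact hess γ ⟨h1, h2, h3, h4⟩
      · have := finrank_add_finrank_le_of_le (le_top : V ≤ ⊤) (le_top : F γ ≤ ⊤)
        rw [finrank_top, Module.finrank_fin_fun, hV] at this
        omega
    · omega
  have h5 := finrank_add_finrank_le_of_le (inf_le_right : V ⊓ F γ ≤ F γ) (h.flag.monotone hβγ)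
  rw [inf_assoc, inf_eq_right.2 (h.flag.monotone hβγ)] at h5
  have h6 := Submodule.finrank_mono (inf_le_inf_left V (h.flag.monotone hβα))
  have hβ' : i β = i α := hβ
  omega

end IsSchubertPair

theorem isClosed_schubert : IsClosed (schubert k F i) := by
  have h : schubert k F i = ⋂ α, {V | i α ≤
      Module.finrank ℂ ((V ()).1 ⊓ F α : Submodule ℂ (Fin l → ℂ))} := by
    ext V
    simp only [schubert, Set.mem_ofPred_eq, Set.mem_iInter]
  rw [h]
  exact isClosed_iInter fun α => isClosed_le_finrank_inf (k := fun _ => k) (n := fun _ => l) () (F α) (i α)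

theorem schubertOpen_subset (h : IsSchubertPair k F i) : schubertOpen k F i ⊆ schubert k F i :=
  fun V hV => h.le_finrank_inf (V ()).2 fun α hα => (hV α hα).ge

theorem isOpen_schubertOpen :
    IsOpen {V : schubert k F i | V.1 ∈ schubertOpen k F i} := by
  have h : {V : schubert k F i | V.1 ∈ schubertOpen k F i} = Subtype.val ⁻¹'
      ⋂ α : {α // IsEssential k F i α}, {V : Grass k l |
        Module.finrank ℂ ((V ()).1 ⊓ F α.1 : Submodule ℂ (Fin l → ℂ)) ≤ i α.1} := by
    ext V
    simp only [schubertOpen, Set.mem_ofPred_eq, Set.mem_preimage, Set.mem_iInter, Subtype.forall]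
    exact forall₂_congr fun α _ => ⟨fun he => he.le, fun hle => le_antisymm hle (V.2 α)⟩
  have hα : ∀ α : {α // IsEssential k F i α}, IsOpen {V : Grass k l |
      Module.finrank ℂ ((V ()).1 ⊓ F α.1 : Submodule ℂ (Fin l → ℂ)) ≤ i α.1} := fun α =>
    isOpen_finrank_inf_le (k := fun _ => k) (n := fun _ => l) () (F α.1) (i α.1)
  rw [h]
  exact (isOpen_iInter_of_finite hα).preimage continuous_subtype_val

/-- The position in the chain `(Z_α)_α, V`. -/
def chainPos : Option {α : Fin m // IsEssential k F i α} → ℕ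
  | some α => α.1
  | none => m

/-- The spaces that contain the members of the chain `(Z_α)_α, V`. -/
def chainSpace : Option {α : Fin m // IsEssential k F i α} → Submodule ℂ (Fin l → ℂ)
  | some α => F α.1
  | none => ⊤

theorem exists_chainStep (p : ℕ) : ∃ a : Option {α : Fin m // IsEssential k F i α}, p < k →
    p < chainDim k F i a ∧ ∀ b, p < chainDim k F i b → chainPos a ≤ chainPos b := by
  by_cases hp : p < k
  · obtain ⟨a, ha, hmin⟩ := Set.exists_min_image
      {a : Option {α : Fin m // IsEssential k F i α} | p < chainDim k F i a} chainPos
      (Set.toFinite _) ⟨none, hp⟩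
    exact ⟨a, fun _ => ⟨ha, hmin⟩⟩
  · exact ⟨none, fun h => absurd h hp⟩

theorem chain_mono (h : IsSchubertPair k F i) (a b : Option {α : Fin m // IsEssential k F i α})
    (hab : chainPos a ≤ chainPos b) :
    chainDim k F i a ≤ chainDim k F i b ∧ (chainSpace a : Submodule ℂ (Fin l → ℂ)) ≤ chainSpace b := by
  rcases a with _ | α <;> rcases b with _ | β
  · exact ⟨le_rfl, le_rfl⟩
  · exact absurd hab (not_le.2 β.1.2)
  · exact ⟨h.le_k _, le_top⟩
  · exact ⟨h.mono hab, h.flag.monotone hab⟩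

/-- The chains `(Z_α)_α, V` of a Schubert pair. -/
abbrev schubertChain (h : IsSchubertPair k F i) :
    ChainData (Option {α : Fin m // IsEssential k F i α}) l where
  dim := chainDim k F i
  pos := chainPos
  space := chainSpace
  top := k
  step p := (exists_chainStep p).choose
  dim_mono a b hab := (chain_mono h a b hab).1
  space_mono a b hab := (chain_mono h a b hab).2
  dim_le_top a := (chain_mono h a none (by rcases a with _ | α; exacts [le_rfl, α.1.2.le])).1
  lt_dim_step p hp := ((exists_chainStep p).choose_spec hp).1
  step_le p hp := ((exists_chainStep p).choose_spec hp).2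

theorem incidence_eq_variety (h : IsSchubertPair k F i) :
    incidence k F i = (schubertChain h).variety := by
  ext x
  constructor
  · rintro ⟨h1, h2, h3⟩
    refine ⟨?_, ?_⟩
    · rintro (_ | α)
      · exact le_top
      · exact h1 α
    · rintro (_ | α) (_ | β) hab
      · exact le_rfl
      · exact absurd hab (not_le.2 β.1.2)
      · exact h3 α
      · exact h2 α β hab
  · rintro ⟨h1, h2⟩
    exact ⟨fun α => h1 (some α), fun α β hab => h2 (some α) (some β) hab,
      fun α => h2 (some α) none α.1.2.le⟩

theorem le_inf_of_mem_incidence {x : ChainAmbient k F i} (hx : x ∈ incidence k F i)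
    (α : {α : Fin m // IsEssential k F i α}) : (x (some α)).1 ≤ (x none).1 ⊓ F α.1 :=
  le_inf (hx.2.2 α) (hx.1 α)

theorem lastSpace_mem_schubert (h : IsSchubertPair k F i) (x : ChainAmbient k F i)
    (hx : x ∈ incidence k F i) : lastSpace k F i x ∈ schubert k F i :=
  h.le_finrank_inf (x none).2 fun α hα => by
    have := Submodule.finrank_mono (le_inf_of_mem_incidence hx ⟨α, hα⟩)
    rwa [(x (some ⟨α, hα⟩)).2] at this

/-- The greedy choice of vectors is made in the spaces `V ∩ F α`, which are large enough exactly
because `V` lies in the Schubert variety. -/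
theorem exists_mem_incidence (h : IsSchubertPair k F i) {V : Grass k l}
    (hV : V ∈ schubert k F i) : ∃ x ∈ incidence k F i, lastSpace k F i x = V := by
  let W : Option {α : Fin m // IsEssential k F i α} → Submodule ℂ (Fin l → ℂ) :=
    fun a => (V ()).1 ⊓ chainSpace a
  obtain ⟨v, hv, hvW⟩ := (schubertChain h).exists_rows_of_finrank W fun a => by
    rcases a with _ | α
    · exact (V ()).2.ge.trans (Submodule.finrank_mono (le_inf le_rfl le_top))
    · exact hV α.1
  refine ⟨_, (incidence_eq_variety h).ge ((schubertChain h).toGr_rows_mem_variety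
    ((schubertChain h).linearIndependent_rows hv) fun p => (hvW p).2), ?_⟩
  funext u
  refine Subtype.ext (Submodule.eq_of_le_of_finrank_eq (Submodule.span_le.2 ?_) ?_)
  · rintro _ ⟨p, rfl⟩
    exact (hvW _).1
  · rw [(V u).2, (lastSpace k F i _ u).2]

theorem eq_inf_of_mem_incidence {x : ChainAmbient k F i} (hx : x ∈ incidence k F i)
    (hV : lastSpace k F i x ∈ schubertOpen k F i) (α : {α : Fin m // IsEssential k F i α}) :
    (x (some α)).1 = (x none).1 ⊓ F α.1 :=
  Submodule.eq_of_le_of_finrank_eq (le_inf_of_mem_incidence hx α)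
    ((x (some α)).2.trans (hV α.1 α.2).symm)

/-- The vectors are chosen in general position: from index `i α` on, each new vector avoids `F α`
plus the span of the previous ones. -/
theorem exists_lastSpace_mem_schubertOpen (hkl : k ≤ l) (h : IsSchubertPair k F i) :
    ∃ x ∈ incidence k F i, lastSpace k F i x ∈ schubertOpen k F i := by
  set c := schubertChain h with hc
  have hstep : ∀ p, ∃ (B : Submodule ℂ (Fin l → ℂ)) (e : ℕ), p < k →
      (∀ q < e, q < p → c.space (c.step q) ≤ B) ∧
      Module.finrank ℂ B + (p - e) < Module.finrank ℂ (c.space (c.step p)) ∧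
      ∀ α, IsEssential k F i α → i α ≤ p → F α ≤ B := by
    intro p
    by_cases hp : p < k
    · have hdim := c.lt_dim_step p hp
      by_cases hex : ∃ α, IsEssential k F i α ∧ i α ≤ p
      · obtain ⟨α, ⟨hα, hαp⟩, hmax⟩ := Set.exists_max_image
          {α | IsEssential k F i α ∧ i α ≤ p} id (Set.toFinite _) hex
        -- Only the last essential `α` with `i α ≤ p` matters, as its space contains the earlier
        -- ones. The first `i α` vectors lie in `F α`, and the slope or the upper bound on `k`
        -- leaves room for the next vector.
        refine ⟨F α, i α, fun _ => ⟨fun q hq hqp => ?_, ?_, fun β hβ hβp => ?_⟩⟩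
        · exact c.space_mono (c.step q) (some ⟨α, hα⟩)
            (c.step_le q (hqp.trans hp) (some ⟨α, hα⟩) hq)
        · rcases hs : c.step p with _ | β
          · rw [hs] at hdim
            have h1 := h.k_le α
            have h2 : Module.finrank ℂ (c.space none) = l := by
              change Module.finrank ℂ (⊤ : Submodule ℂ (Fin l → ℂ)) = l
              rw [finrank_top, Module.finrank_fin_fun]
            omega
          · rw [hs] at hdim
            have hdim' : p < i β.1 := hdim
            have h1 : α ≤ β.1 := by
              by_contra! hlt
              have := h.mono hlt.le
              omega
            have h2 := h.slope α β.1 h1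
            change _ < Module.finrank ℂ (F β.1)
            omega
        · exact h.flag.monotone (hmax β ⟨hβ, hβp⟩)
      · refine ⟨⊥, 0, fun _ => ⟨fun q hq => absurd hq (by omega), ?_, fun α hα hαp =>
          absurd ⟨α, hα, hαp⟩ hex⟩⟩
        rw [finrank_bot]
        rcases hs : c.step p with _ | β
        · have h2 : Module.finrank ℂ (c.space none) = l := by
            change Module.finrank ℂ (⊤ : Submodule ℂ (Fin l → ℂ)) = l
            rw [finrank_top, Module.finrank_fin_fun]
          omega
        · rw [hs] at hdim
          have hdim' : p < i β.1 := hdim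
          have h1 := h.le_dim β.1
          change _ < Module.finrank ℂ (F β.1)
          omega
    · exact ⟨⊥, 0, fun h => absurd h hp⟩
  choose B e hBe using hstep
  obtain ⟨v, hv⟩ := exists_seq_notMem (fun p => c.space (c.step p)) B e k
    (fun p hp => (hBe p hp).1) fun p hp => (hBe p hp).2.1
  have hind : LinearIndependent ℂ (Matrix.of fun (p : Fin k) => v p).row :=
    linearIndependent_of_notMem_span fun p hp hmem => (hv p hp).2 (Submodule.mem_sup_right hmem)
  have hx := c.toGr_rows_mem_variety (c.linearIndependent_rows hind) fun p => (hv p p.2).1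
  refine ⟨_, (incidence_eq_variety h).ge hx, fun α hα => ?_⟩
  set V := (lastSpace k F i (Frame.ofMat (n := fun _ => l) (c.rows (Matrix.of fun (p : Fin k) => v p))
    (c.linearIndependent_rows hind)).toGr) () with hV
  refine le_antisymm ?_ (lastSpace_mem_schubert h _ ((incidence_eq_variety h).ge hx) α)
  -- Each vector from index `i α` on adds a dimension modulo `F α`. At `p = k` this bounds `dim (V ∩
  -- F α)` above by `i α`.
  have hle : ∀ p, i α ≤ p → p ≤ k → Module.finrank ℂ (F α) + (p - i α) ≤
      Module.finrank ℂ (F α ⊔ Submodule.span ℂ (v '' {q | q < p}) :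
        Submodule ℂ (Fin l → ℂ)) := by
    intro p hp
    induction p, hp using Nat.le_induction with
    | base =>
      intro _
      have := Submodule.finrank_mono
        (le_sup_left : F α ≤ F α ⊔ Submodule.span ℂ (v '' {q | q < i α}))
      omega
    | succ p hp ih =>
      intro hpk
      have hlt : F α ⊔ Submodule.span ℂ (v '' {q | q < p}) <
          F α ⊔ Submodule.span ℂ (v '' {q | q < p + 1}) := by
        refine lt_of_le_of_ne (sup_le_sup_left (Submodule.span_mono (Set.image_mono fun q hq =>
          Nat.lt_succ_of_lt hq)) _) fun he => ?_
        refine (hv p (by omega)).2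
          (sup_le_sup_right ((hBe p (by omega)).2.2 α hα hp) _ (he.ge ?_))
        exact Submodule.mem_sup_right (Submodule.subset_span ⟨p, Nat.lt_succ_self p, rfl⟩)
      have := Submodule.finrank_lt_finrank_of_lt hlt
      have := ih (by omega)
      omega
  have h1 := hle k (h.le_k α) le_rfl
  have h2 : Submodule.span ℂ (v '' {q | q < k}) ≤ V.1 := by
    refine Submodule.span_le.2 ?_
    rintro _ ⟨q, hq, rfl⟩
    exact Submodule.subset_span ⟨⟨q, hq⟩, rfl⟩
  have h3 := Submodule.finrank_mono (sup_le_sup_left h2 (F α))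
  have h4 := Submodule.finrank_sup_add_finrank_inf_eq (F α) V.1
  have h5 : Module.finrank ℂ V.1 = k := V.2
  rw [h5, inf_comm] at h4
  have := h.le_k α
  omega

end Schubert

/-! ## Intersections of constant dimension -/

/-- Local frames of the intersection with a fixed space, where its dimension is constant. -/
theorem exists_frame_inf {k l r : ℕ} (F : Submodule ℂ (Fin l → ℂ)) {A : Matrix (Fin k) (Fin l) ℂ}
    (hA : LinearIndependent ℂ A.row)
    (hr : Module.finrank ℂ (Submodule.span ℂ (Set.range A.row) ⊓ F : Submodule ℂ _) = r) :
    ∃ (R : Matrix (Fin l) (Fin k) ℂ) (ε : Fin r → Fin k), (A * R).det ≠ 0 ∧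
      ∀ B : Matrix (Fin k) (Fin l) ℂ, (B * R).det ≠ 0 →
        Module.finrank ℂ (Submodule.span ℂ (Set.range B.row) ⊓ F : Submodule ℂ _) = r →
        LinearIndependent ℂ (((B * R).adjugate * B).submatrix ε id).row ∧
        Submodule.span ℂ (Set.range (((B * R).adjugate * B).submatrix ε id).row) =
          Submodule.span ℂ (Set.range B.row) ⊓ F := by
  set V := Submodule.span ℂ (Set.range A.row) with hV
  obtain ⟨U, hUV, hdU, hU⟩ := exists_relative_compl (inf_le_left : V ⊓ F ≤ V)
  obtain ⟨C, hCF, hdC, hC⟩ := exists_relative_compl (inf_le_right : V ⊓ F ≤ F)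
  obtain ⟨r', N, hr', hN, hNV⟩ := exists_matrix_span_eq (V ⊓ F)
  obtain rfl : r = r' := hr.symm.trans hr'
  obtain ⟨s, u, hs, hu, huU⟩ := exists_matrix_span_eq U
  obtain ⟨t, f, -, hf, hfC⟩ := exists_matrix_span_eq C
  have hk : r + s = k := by
    have h1 := Submodule.finrank_sup_add_finrank_inf_eq (V ⊓ F) U
    have h2 : Module.finrank ℂ V = k := by simpa using finrank_span_eq_card (R := ℂ) hA
    rw [hU, hdU.eq_bot, finrank_bot, hs, hr, h2] at h1
    omega
  subst hk
  have hdisj : Disjoint V C := by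
    rw [disjoint_iff_inf_le] at hdC ⊢
    exact fun x hx => hdC ⟨⟨hx.1, hCF hx.2⟩, hx.2⟩
  have hspan : Submodule.span ℂ (Set.range (Matrix.fromRows N u).row) = V := by
    have h : Set.range (Matrix.fromRows N u).row = Set.range N.row ∪ Set.range u.row :=
      Set.Sum.elim_range _ _
    rw [h, Submodule.span_union, huU, hNV, hU]
  have hNu : LinearIndependent ℂ (Matrix.fromRows N u).row := by
    rw [← huU, ← hNV] at hdU
    exact LinearIndependent.sum_type hN hu hdU
  have hM : LinearIndependent ℂ (Matrix.fromRows (Matrix.fromRows N u) f).row := by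
    rw [← hspan, ← hfC] at hdisj
    exact LinearIndependent.sum_type hNu hf hdisj
  obtain ⟨L, hL⟩ := exists_mul_eq_one_of_linearIndependent hM
  obtain ⟨T, T', rfl⟩ : ∃ R G, L = Matrix.fromCols R G :=
    ⟨L.toCols₁, L.toCols₂, (Matrix.fromCols_toCols L).symm⟩
  rw [Matrix.fromRows_mul_fromCols, ← Matrix.fromBlocks_one, Matrix.fromBlocks_inj] at hL
  have hNuT := hL.1
  have hfT := hL.2.2.1
  let ε : Fin r ⊕ Fin s ≃ Fin (r + s) := finSumFinEquiv
  let R : Matrix (Fin l) (Fin (r + s)) ℂ := T.submatrix id ε.symm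
  -- `R` is dual to a basis of `V` that begins with a basis of `V ∩ F`, and it kills a complement of
  -- `V ∩ F` in `F`. Hence its last `s` columns vanish on `F`.
  have hFR : ∀ x ∈ F, ∀ q, Matrix.vecMul x R (ε (Sum.inr q)) = 0 := by
    intro x hx q
    have h1 : ∀ y, Matrix.vecMul y R (ε (Sum.inr q)) = Matrix.vecMul y T (Sum.inr q) := fun y => by
      change Matrix.vecMul y T (ε.symm (ε (Sum.inr q))) = _
      rw [ε.symm_apply_apply]
    have h2 : F ≤ LinearMap.ker ((LinearMap.proj (Sum.inr q)).comp T.vecMulLinear) := by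
      rw [← hC, ← hNV, ← hfC]
      refine sup_le (Submodule.span_le.2 ?_) (Submodule.span_le.2 ?_)
      · rintro _ ⟨p, rfl⟩
        exact congrFun (congrFun hNuT (Sum.inl p)) (Sum.inr q)
      · rintro _ ⟨p, rfl⟩
        exact congrFun (congrFun hfT p) (Sum.inr q)
    rw [h1]
    exact h2 hx
  refine ⟨R, fun p => ε (Sum.inl p), ?_, fun B hB hBr => ?_⟩
  · obtain ⟨g, hg⟩ := exists_matrix_mul_eq (A := A) (B := (Matrix.fromRows N u).submatrix ε.symm id)
      fun p => by
        rw [← hV, ← hspan]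
        exact Submodule.subset_span ⟨ε.symm p, rfl⟩
    have h1 : (Matrix.fromRows N u).submatrix ε.symm id * R = 1 := by
      rw [← Matrix.submatrix_mul _ _ _ _ _ Function.bijective_id, hNuT, Matrix.submatrix_one_equiv]
    rw [hg, Matrix.mul_assoc] at h1
    intro h0
    have := congrArg Matrix.det h1
    simp [Matrix.det_mul, h0] at this
  · set G := (B * R).adjugate * B with hG
    -- The adjugate replaces the inverse to keep the entries polynomial. Vectors of the intersection
    -- have no components along the last `s` rows of `G`, and the dimension `r` gives equality.
    have hdet : (B * R).adjugate.det ≠ 0 := by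
      rw [Matrix.det_adjugate]
      exact pow_ne_zero _ hB
    have hGR : G * R = (B * R).det • 1 := by
      rw [hG, Matrix.mul_assoc, Matrix.adjugate_mul]
    have hGind : LinearIndependent ℂ G.row :=
      linearIndependent_matrix_mul hdet (linearIndependent_of_det_mul_ne_zero hB)
    have hind : LinearIndependent ℂ (G.submatrix (fun p => ε (Sum.inl p)) id).row :=
      hGind.comp _ (ε.injective.comp Sum.inl_injective)
    refine ⟨hind, (Submodule.eq_of_le_of_finrank_eq (fun x hx => ?_) ?_).symm⟩
    · have hxG := hx.1
      rw [← span_matrix_mul_eq hdet B] at hxG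
      obtain ⟨z, hz⟩ := (Submodule.mem_span_range_iff_exists_fun ℂ).1 hxG
      have hz' : Matrix.vecMul z G = x := by
        rw [Matrix.vecMul_eq_sum, ← hz]
        rfl
      have hzero : ∀ q, z (ε (Sum.inr q)) = 0 := fun q => by
        have h2 := hFR x hx.2 q
        rw [← hz', Matrix.vecMul_vecMul, hGR, Matrix.vecMul_smul, Matrix.vecMul_one] at h2
        exact (mul_eq_zero.1 h2).resolve_left hB
      rw [← hz, ← ε.sum_comp, Fintype.sum_sum_type]
      refine Submodule.add_mem _ (Submodule.sum_mem _ fun p _ => Submodule.smul_mem _ _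
        (Submodule.subset_span ⟨p, rfl⟩)) (Submodule.sum_mem _ fun q _ => ?_)
      rw [hzero, zero_smul]
      exact Submodule.zero_mem _
    · rw [hBr]
      simpa using (finrank_span_eq_card (R := ℂ) hind).symm

/-! ## Morphisms of incidence varieties -/

section Schubert

variable {k l m : ℕ} {F : Fin m → Submodule ℂ (Fin l → ℂ)} {i : Fin m → ℕ}

theorem isMorphism_of_eq_lastSpace {X : Set (ChainAmbient k F i)} {Y : Set (Grass k l)}
    {f : X → Y} (hf : ∀ x, (f x).1 = lastSpace k F i x.1) : IsMorphism f :=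
  IsMorphism.of_lift fun A _ => ⟨fun _ => 1, fun v s => v ⟨none, s.2⟩, IsPoly.const 1,
    fun s => IsPoly.coord _, one_ne_zero, fun B y hB _ =>
      ⟨Frame.ofMat (k := fun _ => k) (n := fun _ => l) (fun _ => B.mat none)
        fun _ => B.linearIndependent_mat none, by rw [hf, ← hB]; rfl, rfl⟩⟩

theorem isMorphism_of_eq_inf {X : Set (ChainAmbient k F i)} {Y : Set (Grass k l)} {g : Y → X}
    (hY : Y ⊆ schubertOpen k F i) (hg : ∀ y u, ((g y).1 none).1 = (y.1 u).1)
    (hgα : ∀ y α, ((g y).1 (some α)).1 = (y.1 ()).1 ⊓ F α.1) : IsMorphism g := by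
  classical
  refine IsMorphism.of_lift fun A hA => ?_
  choose R ε hR hε using fun α : {α // IsEssential k F i α} =>
    exists_frame_inf (F α.1) (A.linearIndependent_mat ()) (hY hA α.1 α.2)
  let M : (Coord (fun _ : Unit => k) (fun _ => l) → ℂ) →
      ∀ a : Option {α // IsEssential k F i α}, Matrix (Fin (chainDim k F i a)) (Fin l) ℂ :=
    fun v a => match a with
      | some α => ((matOf v () * R α).adjugate * matOf v ()).submatrix (ε α) id
      | none => matOf v ()
  have hv : ∀ p q, IsPoly fun v : Coord (fun _ : Unit => k) (fun _ => l) → ℂ => matOf v () p q :=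
    isPoly_matOf (k := fun _ => k) (n := fun _ => l) ()
  have hMpoly : ∀ a p q, IsPoly fun v => M v a p q := by
    rintro (_ | α) p q
    · exact hv p q
    · exact IsPoly.matrix_mul (IsPoly.adjugate (IsPoly.matrix_mul (N := fun _ => R α) hv
        fun _ _ => IsPoly.const _)) hv (ε α p) q
  refine ⟨fun v => ∏ α, (matOf v () * R α).det, fun v s => M v s.1 s.2.1 s.2.2,
    IsPoly.prod _ fun α _ => isPoly_det_mul hv _, fun s => hMpoly _ _ _,
    Finset.prod_ne_zero_iff.2 fun α _ => hR α, fun B y hB hne => ?_⟩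
  have hne' : ∀ α, (matOf B.coords () * R α).det ≠ 0 := fun α =>
    Finset.prod_ne_zero_iff.1 hne α (Finset.mem_univ α)
  have hBy : Submodule.span ℂ (Set.range (B.mat ()).row) = (y.1 ()).1 := by
    rw [← hB]
    rfl
  have hBα := fun α => hε α (B.mat ()) (hne' α) (by rw [hBy]; exact hY y.2 α.1 α.2)
  have hind : ∀ a, LinearIndependent ℂ (M B.coords a).row := by
    rintro (_ | α)
    · exact B.linearIndependent_mat ()
    · exact (hBα α).1
  refine ⟨Frame.ofMat (n := fun _ => l) (M B.coords) hind, ?_, rfl⟩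
  funext a
  refine Subtype.ext ?_
  rcases a with _ | α
  · exact hBy.trans (hg y ()).symm
  · rw [hgα, ← hBy]
    exact (hBα α).2

theorem isIsomorphismOver_schubertOpen (h : IsSchubertPair k F i)
    {π : incidence k F i → schubert k F i} (hπ : ∀ x, (π x).1 = lastSpace k F i x.1) :
    IsIsomorphismOver π {V | V.1 ∈ schubertOpen k F i} := by
  have hsurj : ∀ y : (Subtype.val '' {V : schubert k F i | V.1 ∈ schubertOpen k F i} :
      Set (Grass k l)), ∃ x : (Subtype.val '' (π ⁻¹' {V | V.1 ∈ schubertOpen k F i}) :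
        Set (ChainAmbient k F i)), lastSpace k F i x.1 = y.1 := by
    rintro ⟨_, V, hV, rfl⟩
    obtain ⟨x, hx, hxV⟩ := exists_mem_incidence h V.2
    refine ⟨⟨x, ⟨x, hx⟩, ?_, rfl⟩, hxV⟩
    change (π ⟨x, hx⟩).1 ∈ schubertOpen k F i
    rw [hπ, hxV]
    exact hV
  choose g hg using hsurj
  have hmem : ∀ x : (Subtype.val '' (π ⁻¹' {V | V.1 ∈ schubertOpen k F i}) :
      Set (ChainAmbient k F i)), x.1 ∈ incidence k F i ∧
        lastSpace k F i x.1 ∈ schubertOpen k F i := by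
    rintro ⟨_, x, hx, rfl⟩
    refine ⟨x.2, ?_⟩
    rw [← hπ]
    exact hx
  have hr : ∀ x, (restrictOver π {V | V.1 ∈ schubertOpen k F i} x).1 = lastSpace k F i x.1 :=
    fun x => hπ _
  have hinj : ∀ x y : (Subtype.val '' (π ⁻¹' {V | V.1 ∈ schubertOpen k F i}) :
      Set (ChainAmbient k F i)), lastSpace k F i x.1 = lastSpace k F i y.1 → x = y := by
    intro x y hxy
    have hnone : x.1 none = y.1 none := congrFun hxy ()
    -- Over the open set `V` determines the chain, because `Z_α = V ∩ F_α` there.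
    refine Subtype.ext (funext fun a => ?_)
    rcases a with _ | α
    · exact hnone
    · refine Subtype.ext ?_
      rw [eq_inf_of_mem_incidence (hmem x).1 (hmem x).2, hnone,
        eq_inf_of_mem_incidence (hmem y).1 (hmem y).2]
  refine ⟨isMorphism_of_eq_lastSpace hr, g, isMorphism_of_eq_inf ?_ (fun y u => ?_) fun y α => ?_,
    fun x => ?_, fun y => ?_⟩
  · rintro _ ⟨V, hV, rfl⟩
    exact hV
  · exact congrArg Subtype.val (congrFun (hg y) u)
  · rw [eq_inf_of_mem_incidence (hmem (g y)).1 (hmem (g y)).2, ← hg y]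
    rfl
  · exact hinj _ _ ((hg _).trans (hr x))
  · exact Subtype.ext ((hr _).trans (hg y))

/-! ## Properness -/

theorem continuous_of_lift {f : MultiGr k' n' → MultiGr k'' n''}
    (R : (Coord k' n' → ℂ) → Coord k'' n'' → ℂ) (hR : ∀ s, IsPoly fun v => R v s)
    (h : ∀ B : Frame k' n', ∃ B' : Frame k'' n'', B'.toGr = f B.toGr ∧ B'.coords = R B.coords) :
    Continuous f := by
  refine continuous_def.2 fun U hU => isOpen_iff.2 fun A hA => ?_
  obtain ⟨A', hA', hA'R⟩ := h A
  obtain ⟨g, hg, hgA, hgU⟩ := isOpen_iff.1 hU A' (hA' ▸ hA)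
  refine ⟨_, hg.comp hR, hA'R ▸ hgA, fun B hB => ?_⟩
  obtain ⟨B', hB', hB'R⟩ := h B
  rw [Set.mem_preimage, ← hB']
  exact hgU B' (hB'R ▸ hB)

/-- The restriction of families of spaces to a part of the index set. -/
def restrictInl {k₁ n₁ : ι₁ → ℕ} {k₂ n₂ : ι₂ → ℕ}
    (w : MultiGr (Sum.elim k₁ k₂) (Sum.elim n₁ n₂)) : MultiGr k₁ n₁ :=
  fun a => w (Sum.inl a)

theorem continuous_restrictInl {k₁ n₁ : ι₁ → ℕ} {k₂ n₂ : ι₂ → ℕ} :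
    Continuous (restrictInl : MultiGr (Sum.elim k₁ k₂) (Sum.elim n₁ n₂) → MultiGr k₁ n₁) :=
  continuous_of_lift (fun v (s : Coord k₁ n₁) => v ⟨Sum.inl s.1, s.2⟩) (fun _ => IsPoly.coord _)
    fun B => ⟨Frame.ofMat (fun a => B.mat (Sum.inl a)) fun a => B.linearIndependent_mat (Sum.inl a),
      rfl, rfl⟩

/-- Add fixed spaces `Z_α` to the space `V` of a family. -/
def addChain {k₂ n₂ : κ → ℕ} (A : Frame (chainDim k F i) fun _ => l)
    (w : MultiGr (Sum.elim (fun _ : Unit => k) k₂) (Sum.elim (fun _ : Unit => l) n₂)) :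
    MultiGr (Sum.elim (chainDim k F i) k₂) (Sum.elim (fun _ => l) n₂)
  | Sum.inl none => w (Sum.inl ())
  | Sum.inl (some α) => A.toGr (some α)
  | Sum.inr b => w (Sum.inr b)

/-- The matrices of `addChain`. -/
def addChainMat {k₂ n₂ : κ → ℕ} (A : Frame (chainDim k F i) fun _ => l)
    (v : Coord (Sum.elim (fun _ : Unit => k) k₂) (Sum.elim (fun _ : Unit => l) n₂) → ℂ) :
    ∀ a : Option {α // IsEssential k F i α} ⊕ κ,
      Matrix (Fin (Sum.elim (chainDim k F i) k₂ a)) (Fin (Sum.elim (fun _ => l) n₂ a)) ℂ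
  | Sum.inl none => matOf v (Sum.inl ())
  | Sum.inl (some α) => A.mat (some α)
  | Sum.inr b => matOf v (Sum.inr b)

theorem continuous_addChain {k₂ n₂ : κ → ℕ} (A : Frame (chainDim k F i) fun _ => l) :
    Continuous (addChain A : MultiGr (Sum.elim (fun _ : Unit => k) k₂) (Sum.elim _ n₂) → _) := by
  refine continuous_of_lift (fun v s => addChainMat A v s.1 s.2.1 s.2.2) ?_ fun B =>
    ⟨Frame.ofMat (addChainMat A B.coords) ?_, ?_, rfl⟩
  · rintro ⟨((_ | α) | b), p, q⟩
    · exact IsPoly.coord _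
    · exact IsPoly.const _
    · exact IsPoly.coord _
  · rintro ((_ | α) | b)
    · exact B.linearIndependent_mat (Sum.inl ())
    · exact A.linearIndependent_mat (some α)
    · exact B.linearIndependent_mat (Sum.inr b)
  · funext a
    rcases a with (_ | α) | b <;> rfl

/-- The map forgets the spaces `Z_α`, so closedness of images is completeness of Grassmannians. The
frame `A` only supplies dummy values for the forgotten spaces. -/
theorem isProperMorphism_of_eq_lastSpace {X : Set (ChainAmbient k F i)} (hX : IsClosed X)
    (A : Frame (chainDim k F i) fun _ => l) {Y : Set (Grass k l)} {f : X → Y}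
    (hf : ∀ x, (f x).1 = lastSpace k F i x.1) : IsProperMorphism f where
  morphism := isMorphism_of_eq_lastSpace hf
  universallyClosed := by
    classical
    intro κ _ k₂ n₂ Z _ S hS
    obtain ⟨C, hC, rfl⟩ := isClosed_induced_iff.1 hS
    have hC' := isClosed_forget (hC.inter (hX.preimage continuous_restrictInl))
      (Finset.univ.image fun α : {α // IsEssential k F i α} => Sum.inl (some α))
    refine isClosed_induced_iff.2 ⟨_, hC'.preimage (continuous_addChain A), ?_⟩
    ext y
    constructor
    · rintro ⟨w, ⟨hwC, hwX⟩, hwy⟩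
      have h1 : w (Sum.inl none) = y.1 (Sum.inl ()) := hwy _ (by simp)
      have h2 : ∀ b, w (Sum.inr b) = y.1 (Sum.inr b) := fun b => hwy _ (by simp)
      have hwZ : (fun b => w (Sum.inr b) : MultiGr k₂ n₂) ∈ Z := by
        rw [funext h2]
        exact y.2.2
      refine ⟨⟨w, hwX, hwZ⟩, hwC, Subtype.ext (funext fun a => ?_)⟩
      rcases a with u | b
      · exact (congrFun (hf _) u).trans h1
      · exact h2 b
    · rintro ⟨w, hw, rfl⟩
      refine ⟨w.1, ⟨hw, w.2.1⟩, fun a ha => ?_⟩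
      rcases a with (_ | α) | b
      · exact (congrFun (hf ⟨restrictInl w.1, w.2.1⟩) ()).symm
      · exact absurd (Finset.mem_image_of_mem _ (Finset.mem_univ α)) ha
      · rfl

end Schubert

end SchubertResolution

end

/-! ### The resolution of singularities -/

theorem corollary3p1 (k l m : ℕ) (hk : 0 < k) (hkl : k ≤ l)
    (F : Fin m → Submodule ℂ (Fin l → ℂ)) (i : Fin m → ℕ) (h : IsSchubertPair k F i) :
    IsClosed (schubert k F i) ∧ IsClosed (incidence k F i) ∧ IsSmooth (incidence k F i) ∧
    ∃ hπ : ∀ x ∈ incidence k F i, lastSpace k F i x ∈ schubert k F i,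
      let π : incidence k F i → schubert k F i := fun x => ⟨lastSpace k F i x.1, hπ x.1 x.2⟩
      let U : Set (schubert k F i) := {V | V.1 ∈ schubertOpen k F i}
      IsResolution π ∧
      schubertOpen k F i ⊆ schubert k F i ∧ IsOpen U ∧ Dense U ∧ Dense (π ⁻¹' U) ∧
      IsIsomorphismOver π U := by
  have hclosed : IsClosed (incidence k F i) := by
    rw [incidence_eq_variety h]
    exact (schubertChain h).isClosed_variety
  have hsmooth : IsSmooth (incidence k F i) := by
    rw [incidence_eq_variety h]
    exact (schubertChain h).isSmooth_variety
  obtain ⟨x, hx, hxU⟩ := exists_lastSpace_mem_schubertOpen hkl h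
  have hirr : IrreducibleSpace (incidence k F i) := by
    have hne : (incidence k F i).Nonempty := ⟨x, hx⟩
    rw [incidence_eq_variety h] at hne ⊢
    exact (schubertChain h).irreducibleSpace_variety hne
  obtain ⟨A, -⟩ := Frame.toGr_surjective x
  refine ⟨isClosed_schubert, hclosed, hsmooth, lastSpace_mem_schubert h, ?_⟩
  intro π U
  have hπ : ∀ y, (π y).1 = lastSpace k F i y.1 := fun y => rfl
  have hmor : IsMorphism π := isMorphism_of_eq_lastSpace hπ
  have hUopen : IsOpen U := isOpen_schubertOpen
  -- A nonempty open subset of an irreducible space is dense.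
  have hpre : Dense (π ⁻¹' U) :=
    (hUopen.preimage hmor.continuous).dense ⟨⟨x, hx⟩, hxU⟩
  have hsurj : Function.Surjective π := fun V => by
    obtain ⟨y, hy, hyV⟩ := exists_mem_incidence h V.2
    exact ⟨⟨y, hy⟩, Subtype.ext hyV⟩
  have hU : Dense U := by
    have := hsurj.denseRange.dense_image hmor.continuous hpre
    rwa [Set.image_preimage_eq _ hsurj] at this
  have hiso : IsIsomorphismOver π U := isIsomorphismOver_schubertOpen h hπ
  exact ⟨⟨hirr, hsmooth, isProperMorphism_of_eq_lastSpace hclosed A hπ,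
    hmor, U, hUopen, hU, hpre, hiso⟩, schubertOpen_subset h, hUopen, hU, hpre, hiso⟩
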